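/- **Theorem.** Let $\mathbf d=(d_1,\dots,d_n)$ be positive integers with even sum. The configuration model $\mathrm{CM}_n(\mathbf d)$ is the random multigraph on $[n]=\{1,\dots,n\}$ obtained by attaching $d_i$ half-edges to vertex $i$ and pairing all half-edges uniformly at random. Let $A$ be its adjacency matrix ($A_{ij}$ is the number of edges between $i\neq j$, and $A_{ii}$ is twice the number of self-loops at $i$), let $t_i=\tfrac12\sum_{j,k:\ i,j,k\text{ distinct}}A_{ij}A_{jk}A_{ki}$ be the number of triangles at $i$, counted with multiplicity, and let $$\Delta^T_{[n]}=\frac1n\sum_{i\in[n]}\Big[\frac1{d_i}\sum_{j\in[n]}A_{ij}t_j-t_i\Big]$$ be the triangle friendship bias. Write $m_k=\sum_{i\in[n]}d_i^k$. (a) If $m_1>7$, then $$\mathbb E[\Delta^T_{[n]}]=\frac{1}{2(m_1-1)(m_1-3)(m_1-5)(m_1-7)}\Big(\frac{A_1+A_2+A_3}{n}+(B_1+B_2+B_3)\Big),$$ where $$\begin{aligned} A_1&=6m_1m_3-18m_1m_4+14m_1m_5-2m_1m_6+4m_2m_3-8m_2m_4+4m_3^2,\\ A_2&=-14m_1m_2m_3+3m_1m_2m_4-9m_1^2m_2+18m_1^2m_3-5m_1^2m_4+3m_1m_2^2+4m_2^3,\\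 A_3&=-7m_1^3m_2-m_1m_2^3+5m_1^2m_2^2+3m_1^4,\\ B_1&=2m_7-10m_6+14m_5-6m_4,\\ B_2&=6m_1m_3-8m_1m_4+2m_1m_5-13m_2m_3+11m_2m_4-2m_2m_5-m_3m_4+3m_2^2+2m_3^2,\\ B_3&=-2m_1m_2m_3-3m_1^2m_2+m_1^2m_3+6m_1m_2^2+m_2^2m_3-3m_2^3. \end{aligned}$$ For (b) and (c), let $n\to\infty$ along an arbitrary sequence of numbers of vertices, with a degree sequence $\mathbf d=\mathbf d^{(n)}$ as above for each term, such that $c_k=\lim n^{-1}m_k$ exists in $(0,\infty)$ for $1\le k\le 7$. (b) We have $$\lim \mathbb E[n\Delta^T_{[n]}]=\zeta(c_1,c_2,c_3):=\frac{(c_2-c_1)^2}{2c_1^4}\big[(c_3-c_1c_2)-3(c_2-c_1^2)\big]\ \ge 0 .$$ Equality $\zeta(c_1,c_2,c_3)=0$ holds if and only if $c_2=c_1^2$ or the fraction of vertices of degree at least $3$ tends to $0$. (So, if that fraction does not tend to $0$, equality holds if and only if $c_2=c_1^2$.) Moreover, $c_2=c_1^2$ if and only if the graphs are asymptotically regular,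 i.e., there is an integer $D\ge1$ such that the fraction of vertices of degree different from $D$ tends to $0$ and $c_k=D^k$ for $1\le k\le 6$. (c) We have $\liminf \mathbb P(n\Delta^T_{[n]}=0)>0$. Consequently, if $\zeta(c_1,c_2,c_3)\neq0$, the weak law of large numbers fails: $n\Delta^T_{[n]}-\mathbb E[n\Delta^T_{[n]}]$ does not converge to $0$ in probability. -/

import Mathlib

open MeasureTheory ProbabilityTheory Filter Topology

noncomputable section

/-! ### Triangle friendship-bias of a finite multigraph

A finite undirected multigraph on `Fin n` is given by its adjacency matrix `A`: for `i ≠ j`, `A i j`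
is the number of edges between `i` and `j`, and `A i i` is twice the number of self-loops at `i`. -/

/-- The degree of vertex `i` (every self-loop counts twice). -/
def degree {n : ℕ} (A : Matrix (Fin n) (Fin n) ℕ) (i : Fin n) : ℕ := ∑ j, A i j

/-- The number `t_i` of triangles at vertex `i`, counted with the multiplicities of their edges:
half the sum of `A i j * A j k * A k i` over the `j, k` for which `i, j, k` are distinct. -/
def triangles {n : ℕ} (A : Matrix (Fin n) (Fin n) ℕ) (i : Fin n) : ℝ :=
  (1 / 2) * ∑ j, ∑ k, if i ≠ j ∧ j ≠ k ∧ i ≠ k then ((A i j * A j k * A k i : ℕ) : ℝ) else 0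

/-- The triangle friendship-bias of vertex `i`. -/
def vertexBias {n : ℕ} (A : Matrix (Fin n) (Fin n) ℕ) (i : Fin n) : ℝ :=
  if degree A i ≠ 0 then
    (1 / (degree A i : ℝ)) * ∑ j, (A i j : ℝ) * triangles A j - triangles A i
  else 0

/-- The triangle friendship bias of the whole graph: the average over its vertices. -/
def TFB {n : ℕ} (A : Matrix (Fin n) (Fin n) ℕ) : ℝ := (1 / (n : ℝ)) * ∑ i, vertexBias A i

/-! ### The configuration model -/

/-- The half-edges: vertex `i` carries `d i` of them. -/
abbrev HalfEdge {n : ℕ} (d : Fin n → ℕ) : Type := Σ i : Fin n, Fin (d i)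

/-- A pairing (perfect matching) of the half-edges, as a fixed-point-free involution. -/
def Pairing {n : ℕ} (d : Fin n → ℕ) : Type :=
  {σ : HalfEdge d → HalfEdge d // (∀ h, σ (σ h) = h) ∧ ∀ h, σ h ≠ h}

instance {n : ℕ} (d : Fin n → ℕ) : Finite (Pairing d) := Subtype.finite

instance {n : ℕ} (d : Fin n → ℕ) : MeasurableSpace (Pairing d) := ⊤

instance {n : ℕ} (d : Fin n → ℕ) : DiscreteMeasurableSpace (Pairing d) := ⟨fun _ => trivial⟩

/-- The adjacency matrix of the multigraph in which every pair of half-edges becomes an edge. -/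
def Pairing.adj {n : ℕ} {d : Fin n → ℕ} (σ : Pairing d) : Matrix (Fin n) (Fin n) ℕ :=
  fun i j => ∑ a : Fin (d i), ∑ b : Fin (d j), if σ.1 ⟨i, a⟩ = ⟨j, b⟩ then 1 else 0

/-- The configuration model with degree sequence `d`: a uniformly random pairing of the half-edges.
This is a probability measure when `∑ i, d i` is even. -/
def CM {n : ℕ} (d : Fin n → ℕ) : Measure (Pairing d) := uniformOn Set.univ

/-- The degrees in the configuration model are the prescribed ones. -/
theorem Pairing.degree_adj {n : ℕ} {d : Fin n → ℕ} (σ : Pairing d) (i : Fin n) :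
    degree σ.adj i = d i := by
  unfold degree Pairing.adj
  have h : ∀ a : Fin (d i),
      (∑ j, ∑ b : Fin (d j), if σ.1 ⟨i, a⟩ = ⟨j, b⟩ then 1 else 0) = 1 := by
    intro a
    have := Fintype.sum_sigma (fun x : HalfEdge d => if σ.1 ⟨i, a⟩ = x then 1 else 0)
    rw [← this]
    simp
  rw [Finset.sum_comm, Finset.sum_congr rfl fun a _ => h a]
  simp

/-- The moment sums `m_k = ∑ i, (d i) ^ k`. -/
def degMoment {n : ℕ} (d : Fin n → ℕ) (k : ℕ) : ℝ := ∑ i, (d i : ℝ) ^ k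

/-- The polynomial `A₁ + A₂ + A₃` in the moment sums `m k`. -/
def polyA (m : ℕ → ℝ) : ℝ :=
  (6 * m 1 * m 3 - 18 * m 1 * m 4 + 14 * m 1 * m 5 - 2 * m 1 * m 6 + 4 * m 2 * m 3
    - 8 * m 2 * m 4 + 4 * m 3 ^ 2)
  + (-14 * m 1 * m 2 * m 3 + 3 * m 1 * m 2 * m 4 - 9 * m 1 ^ 2 * m 2 + 18 * m 1 ^ 2 * m 3
    - 5 * m 1 ^ 2 * m 4 + 3 * m 1 * m 2 ^ 2 + 4 * m 2 ^ 3)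
  + (-7 * m 1 ^ 3 * m 2 - m 1 * m 2 ^ 3 + 5 * m 1 ^ 2 * m 2 ^ 2 + 3 * m 1 ^ 4)

/-- The polynomial `B₁ + B₂ + B₃` in the moment sums `m k`. -/
def polyB (m : ℕ → ℝ) : ℝ :=
  (2 * m 7 - 10 * m 6 + 14 * m 5 - 6 * m 4)
  + (6 * m 1 * m 3 - 8 * m 1 * m 4 + 2 * m 1 * m 5 - 13 * m 2 * m 3 + 11 * m 2 * m 4
    - 2 * m 2 * m 5 - m 3 * m 4 + 3 * m 2 ^ 2 + 2 * m 3 ^ 2)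
  + (-2 * m 1 * m 2 * m 3 - 3 * m 1 ^ 2 * m 2 + m 1 ^ 2 * m 3 + 6 * m 1 * m 2 ^ 2
    + m 2 ^ 2 * m 3 - 3 * m 2 ^ 3)

/-- The limit `ζ(c₁, c₂, c₃)`. -/
def zeta (c₁ c₂ c₃ : ℝ) : ℝ :=
  (c₂ - c₁) ^ 2 / (2 * c₁ ^ 4) * ((c₃ - c₁ * c₂) - 3 * (c₂ - c₁ ^ 2))

/-- The fraction of the `n` vertices whose degree satisfies `p`. -/
def fractionOf {n : ℕ} (d : Fin n → ℕ) (p : ℕ → Prop) : ℝ :=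
  (Nat.card {i : Fin n // p (d i)} : ℝ) / n

end

/-!
Write `m` for the number of half-edges, and `L ⊆ σ` when the edges of the list `L` all occur in the
pairing `σ`.

**Rewiring.** If a pairing contains the edge `{x, y}`, interchanging the half-edges `y` and `z`
gives a pairing with the edge `{x, z}`, and this is injective (`Pairing.swapConj`). Hence all
admissible partners of `x` are equally likely given `L ⊆ σ`, so that `k` disjoint edges are
contained with probability `1 / ((m - 1)(m - 3)⋯(m - 2k + 1))`
(`Pairing.prod_mul_count_contains`). The rewiring creates no edges away from `x` and `y`;
therefore the event `L ⊆ σ` is negatively correlated with avoiding any family of edge sets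
disjoint from `L` (`Pairing.prod_mul_count_contains_avoid_le`).

**Expectation.** Exchanging summations, the total bias is the sum, over all vertices `j` and all
triangles at `j`, of `(∑ y, weight (σ y)) - 1`, where `y` runs over the half-edges at `j` and a
half-edge at `i` has the weight `1 / d i` (`Pairing.card_mul_TFB`).
Given the triangle, the partners of two of these half-edges are known, and the partner of every
other one is uniform among the free half-edges, whose weights sum to `n` minus an explicit
term because the weights of all half-edges sum to `n` (`Pairing.sum_triangleEdges_bias`). What is
left is a sum over distinct triples of vertices of products, hence a polynomial in the degree
moments (`sum_distinct_triple`, `sum_triangleBias`).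

**Limit.** Dividing by `n ^ 4` gives `zeta`. Its last factor is the limit of the empirical
covariance of `d` and `d (d - 3)`, which is non-negative since `x (x - 3)` is monotone on the
positive integers and takes equal values only at `1` and `2`. The quantitative version
`fractionOf_mul_variance_le` yields the equality case. When the variance vanishes, the mean is an
integer, and Cauchy-Schwarz propagates the vanishing to weighted quadratic deviations, which gives
the higher moments (`moments_eq_pow_of_variance_eq_zero`).

**No triangles.** By the negative correlation above, the potential triangles satisfy the
hypothesis of the lopsided local lemma (`pow_card_le_measureReal_avoid`): each has probability `p`
of order `n ^ (-3)`, there are at most `m₂ ^ 3 = O(n ^ 3)` of them, and each shares half-edges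
with at most `O(√m₂ * m₂ ^ 2) = o(n ^ 3)` others, where `m₂` is the sum of the squared degrees. So
the probability that there is no triangle, and hence no bias, is bounded below
(`exists_le_CM_eq_zero`). A nonzero limit of the expectations then excludes a weak law of large
numbers.
-/

/-! ### Counting pairings that contain prescribed edges -/

noncomputable instance {n : ℕ} (d : Fin n → ℕ) : Fintype (Pairing d) := Fintype.ofFinite _

namespace Pairing

variable {n : ℕ} {d : Fin n → ℕ}

theorem apply_apply (σ : Pairing d) (h : HalfEdge d) : σ.1 (σ.1 h) = h := σ.2.1 h

theorem apply_eq_comm (σ : Pairing d) {x y : HalfEdge d} : σ.1 x = y ↔ σ.1 y = x :=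
  ⟨fun h => h ▸ σ.apply_apply x, fun h => h ▸ σ.apply_apply y⟩

/-- The pairing `σ` with the half-edges `y` and `z` interchanged. If `σ x = y`, then the result
pairs `x` with `z` and, when `z ≠ y`, the former partner of `z` with `y`. -/
def swapConj (y z : HalfEdge d) (σ : Pairing d) : Pairing d :=
  ⟨fun h => Equiv.swap y z (σ.1 (Equiv.swap y z h)),
    fun h => by simp [σ.apply_apply],
    fun h e => σ.2.2 (Equiv.swap y z h) (by
      rw [← Equiv.swap_apply_self y z (σ.1 _)]
      simp [e])⟩

theorem swapConj_apply (y z : HalfEdge d) (σ : Pairing d) (h : HalfEdge d) :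
    (swapConj y z σ).1 h = Equiv.swap y z (σ.1 (Equiv.swap y z h)) := rfl

theorem swapConj_injective (y z : HalfEdge d) :
    Function.Injective (swapConj (d := d) y z) := by
  refine Function.LeftInverse.injective (g := swapConj y z) fun σ => Subtype.ext ?_
  funext h
  simp [swapConj_apply]

/-- The number of pairings with the property `P`, as a real number. -/
noncomputable def count (P : Pairing d → Prop) : ℝ := by
  classical exact ((Finset.univ.filter P).card : ℝ)

theorem count_eq_sum (P : Pairing d → Prop) [DecidablePred P] :
    count P = ∑ σ, if P σ then (1 : ℝ) else 0 := by
  rw [count, ← Finset.sum_filter, Finset.sum_const, nsmul_eq_mul, mul_one]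
  congr!

theorem count_nonneg (P : Pairing d → Prop) : 0 ≤ count P := Nat.cast_nonneg _

theorem count_mono {P Q : Pairing d → Prop} (h : ∀ σ, P σ → Q σ) : count P ≤ count Q := by
  classical
  exact Nat.cast_le.2 (Finset.card_le_card fun σ => by simpa using h σ)

theorem count_le_count_of_swapConj {P Q : Pairing d → Prop} (y z : HalfEdge d)
    (h : ∀ σ, P σ → Q (swapConj y z σ)) : count P ≤ count Q := by
  classical
  refine Nat.cast_le.2 (Finset.card_le_card_of_injOn (swapConj y z) (fun σ => ?_)
    (swapConj_injective y z).injOn)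
  simpa using h σ

theorem count_eq_sum_partner (P : Pairing d → Prop) (x : HalfEdge d) :
    count P = ∑ z, count fun σ => P σ ∧ σ.1 x = z := by
  classical
  simp only [count_eq_sum]
  rw [Finset.sum_comm]
  refine Finset.sum_congr rfl fun σ _ => ?_
  by_cases h : P σ <;> simp [h]

/-- All edges `{p.1, p.2}` with `p` in the list `L` occur in the pairing `σ`. -/
def Contains (σ : Pairing d) (L : List (HalfEdge d × HalfEdge d)) : Prop :=
  ∀ p ∈ L, σ.1 p.1 = p.2

/-- The half-edges that occur in a list of edges. -/
def endpoints (L : List (HalfEdge d × HalfEdge d)) : List (HalfEdge d) :=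
  L.flatMap fun p => [p.1, p.2]

theorem endpoints_cons (p : HalfEdge d × HalfEdge d) (L : List (HalfEdge d × HalfEdge d)) :
    endpoints (p :: L) = p.1 :: p.2 :: endpoints L := rfl

theorem length_endpoints (L : List (HalfEdge d × HalfEdge d)) :
    (endpoints L).length = 2 * L.length := by
  induction L with
  | nil => rfl
  | cons p L ih => rw [endpoints_cons]; simp [ih]; ring

theorem fst_mem_endpoints {L : List (HalfEdge d × HalfEdge d)} {p : HalfEdge d × HalfEdge d}
    (h : p ∈ L) : p.1 ∈ endpoints L := List.mem_flatMap.2 ⟨p, h, by simp⟩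

theorem snd_mem_endpoints {L : List (HalfEdge d × HalfEdge d)} {p : HalfEdge d × HalfEdge d}
    (h : p ∈ L) : p.2 ∈ endpoints L := List.mem_flatMap.2 ⟨p, h, by simp⟩

theorem contains_cons {σ : Pairing d} {x y : HalfEdge d} {L : List (HalfEdge d × HalfEdge d)} :
    σ.Contains ((x, y) :: L) ↔ σ.Contains L ∧ σ.1 x = y := by
  simp [Contains, and_comm]

theorem Contains.apply_mem {σ : Pairing d} {L : List (HalfEdge d × HalfEdge d)}
    (h : σ.Contains L) {u : HalfEdge d} (hu : u ∈ endpoints L) : σ.1 u ∈ endpoints L := by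
  obtain ⟨p, hp, hu⟩ := List.mem_flatMap.1 hu
  have := h p hp
  simp only [List.mem_cons, List.not_mem_nil, or_false] at hu
  rcases hu with rfl | rfl
  · rw [this]; exact snd_mem_endpoints hp
  · rw [σ.apply_eq_comm.1 this]; exact fst_mem_endpoints hp

theorem Contains.swapConj {σ : Pairing d} {L : List (HalfEdge d × HalfEdge d)}
    (h : σ.Contains L) {y z : HalfEdge d} (hy : y ∉ endpoints L) (hz : z ∉ endpoints L) :
    (σ.swapConj y z).Contains L := by
  intro p hp
  have h1 := fst_mem_endpoints hp
  have h2 := snd_mem_endpoints hp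
  rw [swapConj_apply, Equiv.swap_apply_of_ne_of_ne (ne_of_mem_of_not_mem h1 hy)
    (ne_of_mem_of_not_mem h1 hz), h p hp, Equiv.swap_apply_of_ne_of_ne
    (ne_of_mem_of_not_mem h2 hy) (ne_of_mem_of_not_mem h2 hz)]

theorem swapConj_apply_partner {σ : Pairing d} {x y z : HalfEdge d} (h : σ.1 x = y)
    (hxz : x ≠ z) : (σ.swapConj y z).1 x = z := by
  have hxy : x ≠ y := fun e => σ.2.2 x (h.trans e.symm)
  rw [swapConj_apply, Equiv.swap_apply_of_ne_of_ne hxy hxz, h, Equiv.swap_apply_left]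

/-- Rewiring at the edge `{x, y}` creates no edges away from `x` and `y`. -/
theorem Contains.of_swapConj {σ : Pairing d} {F : List (HalfEdge d × HalfEdge d)}
    {x y z : HalfEdge d} (h : σ.1 x = y) (hxz : x ≠ z) (hF : (σ.swapConj y z).Contains F)
    (hx : x ∉ endpoints F) (hy : y ∉ endpoints F) : σ.Contains F := by
  intro p hp
  have h1 := fst_mem_endpoints hp
  have h2 := snd_mem_endpoints hp
  have e := hF p hp
  have hxy : x ≠ y := fun e => σ.2.2 x (h.trans e.symm)
  have e' : σ.1 (Equiv.swap y z p.1) = Equiv.swap y z p.2 := by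
    rw [← e, swapConj_apply, Equiv.swap_apply_self]
  have p1y := ne_of_mem_of_not_mem h1 hy
  have p2y := ne_of_mem_of_not_mem h2 hy
  have p1z : p.1 ≠ z := fun hz => by
    rw [hz, Equiv.swap_apply_right, σ.apply_eq_comm.1 h, ← Equiv.swap_apply_eq_iff,
      Equiv.swap_apply_of_ne_of_ne hxy hxz] at e'
    exact hx (e' ▸ h2)
  rw [Equiv.swap_apply_of_ne_of_ne p1y p1z] at e'
  have p2z : p.2 ≠ z := fun hz => by
    rw [hz, Equiv.swap_apply_right, ← h] at e'
    have : p.1 = x := by rw [← σ.apply_apply p.1, e', σ.apply_apply]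
    exact hx (this ▸ h1)
  rwa [Equiv.swap_apply_of_ne_of_ne p2y p2z] at e'

/-- The half-edges that can still be paired with `x` in a pairing that contains `L`. -/
def free (x : HalfEdge d) (L : List (HalfEdge d × HalfEdge d)) : Finset (HalfEdge d) :=
  Finset.univ \ (x :: endpoints L).toFinset

theorem mem_free {x z : HalfEdge d} {L : List (HalfEdge d × HalfEdge d)} :
    z ∈ free x L ↔ x ≠ z ∧ z ∉ endpoints L := by
  simp [free, eq_comm]

theorem card_free {x : HalfEdge d} {L : List (HalfEdge d × HalfEdge d)}
    (h : (x :: endpoints L).Nodup) :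
    ((free x L).card : ℝ) = (∑ i, d i : ℕ) - 1 - 2 * L.length := by
  have h1 : (x :: endpoints L).toFinset.card = 2 * L.length + 1 := by
    rw [List.toFinset_card_of_nodup h, List.length_cons, length_endpoints]
  have h2 : (Finset.univ : Finset (HalfEdge d)).card = ∑ i, d i := by simp
  rw [free, Finset.cast_card_sdiff (Finset.subset_univ _), h1, h2]
  push_cast
  ring

theorem Contains.apply_mem_free {σ : Pairing d} {x : HalfEdge d}
    {L : List (HalfEdge d × HalfEdge d)} (h : σ.Contains L) (hx : x ∉ endpoints L) :
    σ.1 x ∈ free x L :=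
  mem_free.2 ⟨(σ.2.2 x).symm, fun h' => hx (by simpa [σ.apply_apply] using h.apply_mem h')⟩

/-- Under uniform pairing conditioned to contain `L`, all free partners of `x` are equally
likely. -/
theorem card_free_mul_count {x y : HalfEdge d} {L : List (HalfEdge d × HalfEdge d)}
    (hx : x ∉ endpoints L) (hy : y ∈ free x L) :
    (free x L).card * count (fun σ : Pairing d => σ.Contains L ∧ σ.1 x = y) =
      count fun σ : Pairing d => σ.Contains L := by
  have key : ∀ y ∈ free x L, ∀ z ∈ free x L,
      count (fun σ : Pairing d => σ.Contains L ∧ σ.1 x = y) ≤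
        count (fun σ : Pairing d => σ.Contains L ∧ σ.1 x = z) := fun y hy z hz =>
    count_le_count_of_swapConj y z fun σ h =>
      ⟨h.1.swapConj (mem_free.1 hy).2 (mem_free.1 hz).2,
        swapConj_apply_partner h.2 (mem_free.1 hz).1⟩
  rw [count_eq_sum_partner (fun σ : Pairing d => σ.Contains L) x,
    ← Finset.sum_subset (Finset.subset_univ (free x L)), ← nsmul_eq_mul, ← Finset.sum_const]
  · exact Finset.sum_congr rfl fun z hz => le_antisymm (key y hy z hz) (key z hz y hy)
  · intro z _ hz
    refine le_antisymm (le_of_le_of_eq (count_mono (Q := fun _ => False) ?_) ?_) (count_nonneg _)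
    · rintro σ ⟨h, rfl⟩
      exact hz (h.apply_mem_free hx)
    · simp [count]

/-- Averaging over the partner of `x` in a uniform pairing conditioned to contain `L`. -/
theorem sum_contains_partner {x : HalfEdge d} {L : List (HalfEdge d × HalfEdge d)}
    (hx : x ∉ endpoints L) (f : HalfEdge d → ℝ) [DecidablePred fun σ : Pairing d => σ.Contains L] :
    (free x L).card * (∑ σ : Pairing d, if σ.Contains L then f (σ.1 x) else 0) =
      (∑ z ∈ free x L, f z) * count fun σ : Pairing d => σ.Contains L := by
  classical
  have h : (∑ σ : Pairing d, if σ.Contains L then f (σ.1 x) else 0) =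
      ∑ z ∈ free x L, f z * count (fun σ : Pairing d => σ.Contains L ∧ σ.1 x = z) := by
    simp only [count_eq_sum, Finset.mul_sum]
    rw [Finset.sum_comm]
    refine Finset.sum_congr rfl fun σ _ => ?_
    split_ifs with hσ
    · simp [hσ, hσ.apply_mem_free hx]
    · simp [hσ]
  rw [h, Finset.mul_sum, Finset.sum_mul]
  refine Finset.sum_congr rfl fun z hz => ?_
  rw [← card_free_mul_count hx hz]
  ring

/-- The number of pairings containing `k` prescribed disjoint edges, times
`(m - 1)(m - 3)⋯(m - 2k + 1)` for the number `m` of half-edges, is the number of all pairings. -/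
theorem prod_mul_count_contains (L : List (HalfEdge d × HalfEdge d)) (h : (endpoints L).Nodup) :
    (∏ i ∈ Finset.range L.length, (((∑ i, d i : ℕ) : ℝ) - 1 - 2 * i)) *
      count (fun σ : Pairing d => σ.Contains L) = Fintype.card (Pairing d) := by
  classical
  induction L with
  | nil => simp [count, Contains]
  | cons p L ih =>
    obtain ⟨x, y⟩ := p
    simp only [endpoints_cons, List.nodup_cons, List.mem_cons, not_or] at h
    have hxL : (x :: endpoints L).Nodup := List.nodup_cons.2 ⟨h.1.2, h.2.2⟩
    rw [List.length_cons, Finset.prod_range_succ, mul_assoc, ← card_free hxL]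
    simp only [contains_cons]
    rw [card_free_mul_count h.1.2 (mem_free.2 ⟨h.1.1, h.2.1⟩), ih h.2.2]

/-- Negative dependence: prescribing disjoint edges makes it harder to avoid a family of edge sets
that have no half-edge in common with the prescribed ones. Rewiring at a prescribed edge never
creates a member of the family. -/
theorem prod_mul_count_contains_avoid_le (L : List (HalfEdge d × HalfEdge d))
    (h : (endpoints L).Nodup) (hm : 2 * L.length ≤ ∑ i, d i)
    (S : Set (List (HalfEdge d × HalfEdge d)))
    (hS : ∀ F ∈ S, ∀ x ∈ endpoints L, x ∉ endpoints F) :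
    (∏ i ∈ Finset.range L.length, (((∑ i, d i : ℕ) : ℝ) - 1 - 2 * i)) *
      count (fun σ : Pairing d => σ.Contains L ∧ ∀ F ∈ S, ¬ σ.Contains F) ≤
        count (fun σ : Pairing d => ∀ F ∈ S, ¬ σ.Contains F) := by
  classical
  induction L with
  | nil => simp [Contains]
  | cons p L ih =>
    obtain ⟨x, y⟩ := p
    simp only [endpoints_cons, List.nodup_cons, List.mem_cons, not_or] at h
    have hxL : (x :: endpoints L).Nodup := List.nodup_cons.2 ⟨h.1.2, h.2.2⟩
    have hm' : 2 * L.length + 2 ≤ ∑ i, d i := by simpa [mul_add] using hm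
    refine le_trans ?_ (ih h.2.2 (by omega) fun F hF u hu =>
      hS F hF u (by simp [endpoints_cons, hu]))
    rw [List.length_cons, Finset.prod_range_succ, mul_assoc, ← card_free hxL]
    refine mul_le_mul_of_nonneg_left ?_ (Finset.prod_nonneg fun i hi => ?_)
    · rw [count_eq_sum_partner (fun σ : Pairing d => σ.Contains L ∧ ∀ F ∈ S, ¬ σ.Contains F) x,
        ← nsmul_eq_mul, ← Finset.sum_const]
      refine le_trans (Finset.sum_le_sum fun z hz => ?_) (Finset.sum_le_sum_of_subset_of_nonneg
        (Finset.subset_univ (free x L)) fun _ _ _ => count_nonneg _)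
      refine count_le_count_of_swapConj y z fun σ hσ => ?_
      obtain ⟨h1, h2⟩ := contains_cons.1 hσ.1
      refine ⟨⟨h1.swapConj h.2.1 (mem_free.1 hz).2, fun F hF hc => hσ.2 F hF ?_⟩,
        swapConj_apply_partner h2 (mem_free.1 hz).1⟩
      exact hc.of_swapConj h2 (mem_free.1 hz).1 (hS F hF x (by simp [endpoints_cons]))
        (hS F hF y (by simp [endpoints_cons]))
    · have hi' : 2 * i + 2 ≤ ∑ i, d i := by
        have := Finset.mem_range.1 hi
        omega
      have : (2 * i + 2 : ℝ) ≤ ((∑ i, d i : ℕ) : ℝ) := by exact_mod_cast hi'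
      linarith

/-- Half-edges can be paired as soon as their number is even. -/
theorem nonempty_of_even (h : Even (∑ i, d i)) : Nonempty (Pairing d) := by
  obtain ⟨k, hk⟩ := h
  have e : HalfEdge d ≃ Fin k × Bool := Fintype.equivOfCardEq (by
    rw [Fintype.card_prod, Fintype.card_bool, Fintype.card_fin, Fintype.card_sigma]
    simp [hk]; ring)
  refine ⟨⟨fun x => e.symm ((e x).1, !(e x).2), fun x => by simp, fun x hx => ?_⟩⟩
  have := congrArg (fun y => (e y).2) hx
  simp at this

end Pairing

/-! ### The expected bias -/

namespace Pairing

variable {n : ℕ} {d : Fin n → ℕ}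

theorem adj_comm (σ : Pairing d) (i j : Fin n) : σ.adj i j = σ.adj j i := by
  unfold adj
  rw [Finset.sum_comm]
  simp only [σ.apply_eq_comm]

/-- The three edges of a potential triangle: `a a'` are half-edges at `j`, `b b'` at `k` and
`c c'` at `l`. -/
def triangleEdges {j k l : Fin n} (a a' : Fin (d j)) (b b' : Fin (d k)) (c c' : Fin (d l)) :
    List (HalfEdge d × HalfEdge d) :=
  [(⟨j, a⟩, ⟨k, b⟩), (⟨k, b'⟩, ⟨l, c⟩), (⟨l, c'⟩, ⟨j, a'⟩)]

open Classical in
theorem adj_mul_adj_mul_adj (σ : Pairing d) (j k l : Fin n) :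
    ((σ.adj j k * σ.adj k l * σ.adj l j : ℕ) : ℝ) =
      ∑ a : Fin (d j), ∑ b : Fin (d k), ∑ b' : Fin (d k), ∑ c : Fin (d l), ∑ c' : Fin (d l),
        ∑ a' : Fin (d j), if σ.Contains (triangleEdges a a' b b' c c') then (1 : ℝ) else 0 := by
  have h : ∀ (a : Fin (d j)) (b b' : Fin (d k)) (c c' : Fin (d l)) (a' : Fin (d j)),
      (if σ.Contains (triangleEdges a a' b b' c c') then (1 : ℝ) else 0) =
        (if σ.1 ⟨j, a⟩ = ⟨k, b⟩ then 1 else 0) * (if σ.1 ⟨k, b'⟩ = ⟨l, c⟩ then 1 else 0) *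
          (if σ.1 ⟨l, c'⟩ = ⟨j, a'⟩ then 1 else 0) := by
    intro a b b' c c' a'
    simp only [Contains, triangleEdges, List.forall_mem_cons, List.not_mem_nil, false_imp_iff,
      implies_true, and_true, ite_and, mul_ite, mul_one, mul_zero]
    split_ifs <;> rfl
  simp only [h, ← Finset.mul_sum, ← Finset.sum_mul]
  simp [adj]

/-- The weight `1 / d i` of a half-edge at the vertex `i`. -/
noncomputable def weight (h : HalfEdge d) : ℝ := 1 / (d h.1 : ℝ)

theorem sum_weight (hd : ∀ i, 0 < d i) : ∑ h : HalfEdge d, weight h = n := by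
  rw [Fintype.sum_sigma]
  have : ∀ i, ∑ a : Fin (d i), weight (d := d) ⟨i, a⟩ = 1 := fun i => by
    have := (hd i).ne'
    simp [weight, this]
  simp [this]

theorem sum_adj_div (σ : Pairing d) (j : Fin n) :
    ∑ i, 1 / (d i : ℝ) * σ.adj i j = ∑ y : Fin (d j), weight (σ.1 ⟨j, y⟩) := by
  classical
  have h : ∀ y : Fin (d j), weight (σ.1 ⟨j, y⟩) =
      ∑ i, ∑ a : Fin (d i), if σ.1 ⟨j, y⟩ = ⟨i, a⟩ then 1 / (d i : ℝ) else 0 := fun y => by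
    rw [← Fintype.sum_sigma (fun x : HalfEdge d => if σ.1 ⟨j, y⟩ = x then 1 / (d x.1 : ℝ) else 0)]
    simp [weight]
  simp only [h]
  rw [Finset.sum_comm]
  refine Finset.sum_congr rfl fun i _ => ?_
  rw [adj_comm]
  simp only [adj, Nat.cast_sum, Nat.cast_ite, Nat.cast_one, Nat.cast_zero, Finset.mul_sum, mul_ite,
    mul_one, mul_zero]

/-- Exchanging the two summations, the total bias counts every triangle at `j` with the weights of
the partners of the half-edges at `j`. -/
theorem card_mul_TFB (hd : ∀ i, 0 < d i) (σ : Pairing d) :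
    n * TFB σ.adj = ∑ j, triangles σ.adj j * ((∑ y, weight (σ.1 ⟨j, y⟩)) - 1) := by
  rcases Nat.eq_zero_or_pos n with rfl | hn
  · simp
  have hn' : (n : ℝ) ≠ 0 := by positivity
  rw [TFB, ← mul_assoc, mul_one_div_cancel hn', one_mul]
  simp only [vertexBias, degree_adj, (hd _).ne', ne_eq, not_false_eq_true, if_true, mul_sub,
    mul_one, Finset.sum_sub_distrib, ← sum_adj_div, Finset.mul_sum]
  rw [Finset.sum_comm]
  congr 1
  refine Finset.sum_congr rfl fun i _ => Finset.sum_congr rfl fun j _ => by ring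

theorem nodup_endpoints_triangleEdges {j k l : Fin n} (hjk : j ≠ k) (hkl : k ≠ l) (hjl : j ≠ l)
    {a a' : Fin (d j)} {b b' : Fin (d k)} {c c' : Fin (d l)} (ha : a ≠ a') (hb : b ≠ b')
    (hc : c ≠ c') : (endpoints (triangleEdges a a' b b' c c')).Nodup := by
  simp [endpoints, triangleEdges, hjk, hjk.symm, hkl, hjl, hjl.symm, ha, hb, hc]

/-- The two half-edges of a triangle at each of its vertices are distinct. -/
theorem Contains.ne_of_triangleEdges {σ : Pairing d} {j k l : Fin n} (hjk : j ≠ k) (hkl : k ≠ l)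
    (hjl : j ≠ l) {a a' : Fin (d j)} {b b' : Fin (d k)} {c c' : Fin (d l)}
    (h : σ.Contains (triangleEdges a a' b b' c c')) : a ≠ a' ∧ b ≠ b' ∧ c ≠ c' := by
  simp only [Contains, triangleEdges, List.forall_mem_cons, List.not_mem_nil, false_imp_iff,
    implies_true, and_true] at h
  obtain ⟨h1, h2, h3⟩ := h
  refine ⟨?_, ?_, ?_⟩ <;> rintro rfl
  · rw [σ.apply_eq_comm, h1, Sigma.mk.injEq] at h3
    exact hkl h3.1
  · rw [σ.apply_eq_comm, h2, Sigma.mk.injEq] at h1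
    exact hjl h1.1.symm
  · rw [σ.apply_eq_comm, h3, Sigma.mk.injEq] at h2
    exact hjk h2.1

/-- The contribution to the expected total bias of every potential triangle with degrees `x y z`
at its vertices, seen from the first of them; `n` is the number of vertices and `m` is the number
of half-edges. -/
noncomputable def triangleBias (n m x y z : ℝ) : ℝ :=
  ((1 / y + 1 / z - 1) + (x - 2) * (n - 3 / x - 2 / y - 2 / z) / (m - 7)) /
    ((m - 1) * (m - 3) * (m - 5))

open Classical in
theorem sum_triangleEdges_bias (hd : ∀ i, 0 < d i) {m : ℝ} (hdm : ((∑ i, d i : ℕ) : ℝ) = m)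
    (hm : 7 < m) {j k l : Fin n}
    (hjk : j ≠ k) (hkl : k ≠ l) (hjl : j ≠ l)
    {a a' : Fin (d j)} {b b' : Fin (d k)} {c c' : Fin (d l)} (ha : a ≠ a') (hb : b ≠ b')
    (hc : c ≠ c') :
    ∑ σ : Pairing d, (if σ.Contains (triangleEdges a a' b b' c c') then (1 : ℝ) else 0) *
        ((∑ y, weight (σ.1 ⟨j, y⟩)) - 1) =
      Fintype.card (Pairing d) * triangleBias n m (d j) (d k) (d l) := by
  set L := triangleEdges a a' b b' c c' with hL
  have hnd : (endpoints L).Nodup := nodup_endpoints_triangleEdges hjk hkl hjl ha hb hc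
  have hcount : (m - 1) * (m - 3) * (m - 5) * count (fun σ : Pairing d => σ.Contains L) =
      Fintype.card (Pairing d) := by
    have h3 : L.length = 3 := rfl
    rw [← prod_mul_count_contains L hnd, hdm, h3]
    simp only [Finset.prod_range_succ, Finset.prod_range_zero]
    push_cast
    ring
  set C := count (fun σ : Pairing d => σ.Contains L) with hC
  set R : ℝ := (n - 3 / (d j : ℝ) - 2 / (d k : ℝ) - 2 / (d l : ℝ)) / (m - 7) with hR
  have hm7 : m - 7 ≠ 0 := by linarith
  have key : ∀ y : Fin (d j), (∑ σ : Pairing d, if σ.Contains L then weight (σ.1 ⟨j, y⟩) else 0) =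
      (R + (if y = a then 1 / (d k : ℝ) - R else 0) +
        (if y = a' then 1 / (d l : ℝ) - R else 0)) * C := by
    intro y
    have hconst : ∀ v : HalfEdge d, (∀ σ : Pairing d, σ.Contains L → σ.1 ⟨j, y⟩ = v) →
        (∑ σ : Pairing d, if σ.Contains L then weight (σ.1 ⟨j, y⟩) else 0) = weight v * C := by
      intro v hv
      rw [hC, count_eq_sum, Finset.mul_sum]
      refine Finset.sum_congr rfl fun σ _ => ?_
      split_ifs with h
      · rw [hv σ h, mul_one]
      · rw [mul_zero]
    by_cases hya : y = a
    · subst hya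
      rw [hconst ⟨k, b⟩ fun σ h => h (⟨j, y⟩, ⟨k, b⟩)
        (by simp [hL, triangleEdges])]
      simp [ha, weight]
    by_cases hya' : y = a'
    · subst hya'
      rw [hconst ⟨l, c'⟩ fun σ h => σ.apply_eq_comm.1 (h (⟨l, c'⟩, ⟨j, y⟩)
        (by simp [hL, triangleEdges]))]
      simp [ha.symm, weight]
    have hy : (⟨j, y⟩ : HalfEdge d) ∉ endpoints L := by
      simp [hL, endpoints, triangleEdges, hjk, hjl, hya, hya']
    have hfree := card_free (L := L) (List.nodup_cons.2 ⟨hy, hnd⟩)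
    have hm7' : ((free (⟨j, y⟩ : HalfEdge d) L).card : ℝ) = m - 7 := by
      have h3 : L.length = 3 := rfl
      rw [hfree, hdm, h3]
      push_cast
      ring
    have hsum : ∑ z ∈ free (⟨j, y⟩ : HalfEdge d) L, weight z =
        n - 3 / (d j : ℝ) - 2 / (d k : ℝ) - 2 / (d l : ℝ) := by
      have h1 := Finset.sum_sdiff
        (Finset.subset_univ ((⟨j, y⟩ : HalfEdge d) :: endpoints L).toFinset)
        (f := weight (d := d))
      rw [sum_weight hd, List.sum_toFinset _ (List.nodup_cons.2 ⟨hy, hnd⟩)] at h1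
      simp only [hL, triangleEdges, endpoints, List.flatMap_cons, List.flatMap_nil, List.cons_append,
        List.nil_append, List.map_cons, List.map_nil, List.sum_cons, List.sum_nil, weight] at h1
      simp only [free, hL, triangleEdges, endpoints, List.flatMap_cons, List.flatMap_nil,
        List.cons_append, List.nil_append, weight]
      linear_combination h1
    have := sum_contains_partner hy weight
    rw [hm7', hsum] at this
    simp only [hya, hya', if_false, add_zero, hR]
    field_simp
    linear_combination this
  have hsplit : ∑ σ : Pairing d, (if σ.Contains L then (1 : ℝ) else 0) *
        ((∑ y, weight (σ.1 ⟨j, y⟩)) - 1) =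
      (∑ y : Fin (d j), ∑ σ : Pairing d, if σ.Contains L then weight (σ.1 ⟨j, y⟩) else 0) - C := by
    rw [Finset.sum_comm, hC, count_eq_sum, ← Finset.sum_sub_distrib]
    refine Finset.sum_congr rfl fun σ _ => ?_
    split_ifs <;> simp
  rw [hsplit, Finset.sum_congr rfl fun y _ => key y, ← Finset.sum_mul, Finset.sum_add_distrib,
    Finset.sum_add_distrib, Finset.sum_ite_eq', Finset.sum_ite_eq', ← hcount, triangleBias, hR]
  simp only [Finset.mem_univ, if_true, Finset.sum_const, Finset.card_univ, Fintype.card_fin,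
    nsmul_eq_mul]
  have h135 : (m - 1) * (m - 3) * (m - 5) ≠ 0 :=
    mul_ne_zero (mul_ne_zero (by linarith) (by linarith)) (by linarith)
  rw [mul_right_comm _ C, mul_div_cancel₀ _ h135]
  ring

theorem sum_ne (m : ℕ) (a : Fin m) :
    ∑ a', (if a ≠ a' then (1 : ℝ) else 0) = m - 1 := by
  have h : ∀ a', (if a ≠ a' then (1 : ℝ) else 0) = 1 - if a = a' then 1 else 0 := fun a' => by
    split_ifs <;> simp_all
  simp [h]

theorem sum_card_mul_TFB (hd : ∀ i, 0 < d i) (hm : 7 < ((∑ i, d i : ℕ) : ℝ)) :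
    ∑ σ : Pairing d, n * TFB σ.adj = Fintype.card (Pairing d) * (1 / 2 * ∑ j, ∑ k, ∑ l,
      if j ≠ k ∧ k ≠ l ∧ j ≠ l then
        ((d j : ℝ) * (d j - 1)) * ((d k : ℝ) * (d k - 1)) * ((d l : ℝ) * (d l - 1)) *
          triangleBias n ((∑ i, d i : ℕ) : ℝ) (d j) (d k) (d l) else 0) := by
  classical
  simp only [card_mul_TFB hd, triangles]
  rw [Finset.sum_comm, mul_left_comm, Finset.mul_sum, Finset.mul_sum]
  refine Finset.sum_congr rfl fun j _ => ?_
  simp only [mul_assoc (1 / 2 : ℝ)]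
  rw [← Finset.mul_sum]
  congr 1
  simp only [Finset.sum_mul]
  rw [Finset.sum_comm, Finset.mul_sum]
  refine Finset.sum_congr rfl fun k _ => ?_
  rw [Finset.sum_comm, Finset.mul_sum]
  refine Finset.sum_congr rfl fun l _ => ?_
  split_ifs with h
  · obtain ⟨hjk, hkl, hjl⟩ := h
    have hterm : ∀ (a : Fin (d j)) (b b' : Fin (d k)) (c c' : Fin (d l)) (a' : Fin (d j)),
        ∑ σ : Pairing d, (if σ.Contains (triangleEdges a a' b b' c c') then (1 : ℝ) else 0) *
          ((∑ y, weight (σ.1 ⟨j, y⟩)) - 1) =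
        (if a ≠ a' then 1 else 0) * (if b ≠ b' then 1 else 0) * (if c ≠ c' then 1 else 0) *
          (Fintype.card (Pairing d) * triangleBias n ((∑ i, d i : ℕ) : ℝ) (d j) (d k) (d l)) := by
      intro a b b' c c' a'
      by_cases h : a ≠ a' ∧ b ≠ b' ∧ c ≠ c'
      · rw [sum_triangleEdges_bias hd rfl hm hjk hkl hjl h.1 h.2.1 h.2.2]
        simp [h.1, h.2.1, h.2.2]
      · have h0 : ∀ σ : Pairing d, ¬ σ.Contains (triangleEdges a a' b b' c c') :=
          fun σ hσ => h (hσ.ne_of_triangleEdges hjk hkl hjl)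
        simp only [h0, if_false, zero_mul, Finset.sum_const_zero]
        symm
        by_cases h1 : a = a'
        · simp [h1]
        by_cases h2 : b = b'
        · simp [h2]
        by_cases h3 : c = c'
        · simp [h3]
        exact absurd ⟨h1, h2, h3⟩ h
    simp only [adj_mul_adj_mul_adj, Finset.sum_mul]
    rw [Finset.sum_comm]
    trans ∑ a : Fin (d j), ∑ b : Fin (d k), ∑ b' : Fin (d k), ∑ c : Fin (d l), ∑ c' : Fin (d l),
        ∑ a' : Fin (d j), ∑ σ : Pairing d,
        (if σ.Contains (triangleEdges a a' b b' c c') then (1 : ℝ) else 0) *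
          ((∑ y, weight (σ.1 ⟨j, y⟩)) - 1)
    · refine Finset.sum_congr rfl fun a _ => ?_
      rw [Finset.sum_comm]
      refine Finset.sum_congr rfl fun b _ => ?_
      rw [Finset.sum_comm]
      refine Finset.sum_congr rfl fun b' _ => ?_
      rw [Finset.sum_comm]
      refine Finset.sum_congr rfl fun c _ => ?_
      rw [Finset.sum_comm]
      refine Finset.sum_congr rfl fun c' _ => ?_
      rw [Finset.sum_comm]
    · simp only [hterm]
      simp only [← Finset.sum_mul, ← Finset.mul_sum, sum_ne]
      simp only [Finset.sum_const, Finset.card_univ, Fintype.card_fin, nsmul_eq_mul]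
      ring
  · simp

end Pairing

/-! ### Sums over distinct vertices in terms of the degree moments -/

/-- Inclusion-exclusion for sums over three distinct indices. -/
theorem sum_distinct_triple {n : ℕ} (f g h : Fin n → ℝ) :
    ∑ j, ∑ k, ∑ l, (if j ≠ k ∧ k ≠ l ∧ j ≠ l then f j * g k * h l else 0) =
      (∑ i, f i) * (∑ i, g i) * (∑ i, h i) - (∑ i, f i * g i) * (∑ i, h i)
        - (∑ i, f i * h i) * (∑ i, g i) - (∑ i, g i * h i) * (∑ i, f i)
        + 2 * ∑ i, f i * g i * h i := by
  have key : ∀ j k l, (if j ≠ k ∧ k ≠ l ∧ j ≠ l then f j * g k * h l else 0) =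
      f j * g k * h l - (if j = k then f j * g k * h l else 0)
        - (if k = l then f j * g k * h l else 0) - (if j = l then f j * g k * h l else 0)
        + 2 * (if j = k then (if k = l then f j * g k * h l else 0) else 0) := by
    intro j k l
    by_cases h1 : j = k
    · subst h1
      by_cases h2 : j = l <;> simp [h2]
      ring
    · by_cases h2 : k = l
      · subst h2
        simp [h1]
      · have h2' : l ≠ k := Ne.symm h2
        by_cases h3 : j = l <;> simp [h1, h2, h2', h3]
  have hjk : ∑ j, ∑ k, ∑ l, (if j = k then f j * g k * h l else 0) =
      (∑ i, f i * g i) * (∑ i, h i) := by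
    simp only [Finset.sum_ite_irrel, Finset.sum_const_zero, Finset.sum_ite_eq, Finset.mem_univ,
      if_true, ← Finset.mul_sum, ← Finset.sum_mul]
  have hkl : ∑ j, ∑ k, ∑ l, (if k = l then f j * g k * h l else 0) =
      (∑ i, g i * h i) * (∑ i, f i) := by
    simp only [Finset.sum_ite_eq, Finset.mem_univ, if_true, mul_assoc, ← Finset.mul_sum,
      ← Finset.sum_mul]
    ring
  have hjl : ∑ j, ∑ k, ∑ l, (if j = l then f j * g k * h l else 0) =
      (∑ i, f i * h i) * (∑ i, g i) := by
    simp only [Finset.sum_ite_eq, Finset.mem_univ, if_true, mul_right_comm, ← Finset.mul_sum,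
      ← Finset.sum_mul]
  have hjkl : ∑ j, ∑ k, ∑ l, (if j = k then (if k = l then f j * g k * h l else 0) else 0) =
      ∑ i, f i * g i * h i := by
    simp only [Finset.sum_ite_irrel, Finset.sum_const_zero, Finset.sum_ite_eq, Finset.mem_univ,
      if_true]
  simp only [key, Finset.sum_add_distrib, Finset.sum_sub_distrib, ← Finset.mul_sum, hjk, hkl, hjl,
    hjkl]
  simp only [← Finset.sum_mul, ← Finset.mul_sum]
  ring

theorem degMoment_zero {n : ℕ} (d : Fin n → ℕ) : degMoment d 0 = n := by simp [degMoment]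

theorem degMoment_one {n : ℕ} (d : Fin n → ℕ) : degMoment d 1 = ((∑ i, d i : ℕ) : ℝ) := by
  simp [degMoment]

theorem sum_eq_degMoment {n : ℕ} (d : Fin n → ℕ) {f : Fin n → ℝ} (a : Fin 8 → ℝ)
    (hf : ∀ i, f i = ∑ k, a k * (d i : ℝ) ^ (k : ℕ)) : ∑ i, f i = ∑ k, a k * degMoment d k := by
  simp only [hf, degMoment, Finset.mul_sum]
  exact Finset.sum_comm

theorem sum_triangleBias {n : ℕ} {d : Fin n → ℕ} (hd : ∀ i, 0 < d i) {m : ℝ}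
    (hdm : degMoment d 1 = m) (hm : 7 < m) :
    1 / 2 * (∑ j, ∑ k, ∑ l, if j ≠ k ∧ k ≠ l ∧ j ≠ l then
        ((d j : ℝ) * (d j - 1)) * ((d k : ℝ) * (d k - 1)) * ((d l : ℝ) * (d l - 1)) *
          Pairing.triangleBias n m (d j) (d k) (d l) else 0) =
      1 / (2 * (m - 1) * (m - 3) * (m - 5) * (m - 7)) *
        (polyA (degMoment d) + n * polyB (degMoment d)) := by
  have h1 : m - 1 ≠ 0 := by linarith
  have h3 : m - 3 ≠ 0 := by linarith
  have h5 : m - 5 ≠ 0 := by linarith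
  have h7 : m - 7 ≠ 0 := by linarith
  set g : Fin n → ℝ := fun i => (d i : ℝ) * (d i - 1) with hg
  set q : Fin n → ℝ := fun i => (d i : ℝ) - 1 with hq
  set r : Fin n → ℝ := fun i => (d i : ℝ) * (d i - 1) * (d i - 2) with hr
  set t : Fin n → ℝ := fun i => ((d i : ℝ) - 1) * (d i - 2) with ht
  have hterm : ∀ j k l, (if j ≠ k ∧ k ≠ l ∧ j ≠ l then
        ((d j : ℝ) * (d j - 1)) * ((d k : ℝ) * (d k - 1)) * ((d l : ℝ) * (d l - 1)) *
          Pairing.triangleBias n m (d j) (d k) (d l) else 0) =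
      1 / ((m - 1) * (m - 3) * (m - 5) * (m - 7)) * (
        (m - 7) * (if j ≠ k ∧ k ≠ l ∧ j ≠ l then g j * q k * g l else 0)
        + (m - 7) * (if j ≠ k ∧ k ≠ l ∧ j ≠ l then g j * g k * q l else 0)
        - (m - 7) * (if j ≠ k ∧ k ≠ l ∧ j ≠ l then g j * g k * g l else 0)
        + n * (if j ≠ k ∧ k ≠ l ∧ j ≠ l then r j * g k * g l else 0)
        - 3 * (if j ≠ k ∧ k ≠ l ∧ j ≠ l then t j * g k * g l else 0)
        - 2 * (if j ≠ k ∧ k ≠ l ∧ j ≠ l then r j * q k * g l else 0)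
        - 2 * (if j ≠ k ∧ k ≠ l ∧ j ≠ l then r j * g k * q l else 0)) := by
    intro j k l
    split_ifs
    · have hj : (d j : ℝ) ≠ 0 := Nat.cast_ne_zero.2 (hd j).ne'
      have hk : (d k : ℝ) ≠ 0 := Nat.cast_ne_zero.2 (hd k).ne'
      have hl : (d l : ℝ) ≠ 0 := Nat.cast_ne_zero.2 (hd l).ne'
      simp only [Pairing.triangleBias, hg, hq, hr, ht]
      field_simp
      ring
    · ring
  simp only [hterm, ← Finset.mul_sum, Finset.sum_add_distrib, Finset.sum_sub_distrib,
    sum_distinct_triple]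
  have e : ∀ (f : Fin n → ℝ) (a : Fin 8 → ℝ), (∀ i, f i = ∑ k, a k * (d i : ℝ) ^ (k : ℕ)) →
      ∑ i, f i = ∑ k, a k * degMoment d k := fun f a => sum_eq_degMoment d a
  rw [e (fun i => g i) ![0, -1, 1, 0, 0, 0, 0, 0], e (fun i => q i) ![-1, 1, 0, 0, 0, 0, 0, 0],
    e (fun i => r i) ![0, 2, -3, 1, 0, 0, 0, 0], e (fun i => t i) ![2, -3, 1, 0, 0, 0, 0, 0],
    e (fun i => g i * g i) ![0, 0, 1, -2, 1, 0, 0, 0],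
    e (fun i => g i * q i) ![0, 1, -2, 1, 0, 0, 0, 0],
    e (fun i => q i * g i) ![0, 1, -2, 1, 0, 0, 0, 0],
    e (fun i => r i * g i) ![0, 0, -2, 5, -4, 1, 0, 0],
    e (fun i => t i * g i) ![0, -2, 5, -4, 1, 0, 0, 0],
    e (fun i => r i * q i) ![0, -2, 5, -4, 1, 0, 0, 0],
    e (fun i => g i * g i * g i) ![0, 0, 0, -1, 3, -3, 1, 0],
    e (fun i => g i * q i * g i) ![0, 0, -1, 3, -3, 1, 0, 0],
    e (fun i => g i * g i * q i) ![0, 0, -1, 3, -3, 1, 0, 0],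
    e (fun i => r i * g i * g i) ![0, 0, 0, 2, -7, 9, -5, 1],
    e (fun i => t i * g i * g i) ![0, 0, 2, -7, 9, -5, 1, 0],
    e (fun i => r i * q i * g i) ![0, 0, 2, -7, 9, -5, 1, 0],
    e (fun i => r i * g i * q i) ![0, 0, 2, -7, 9, -5, 1, 0]]
  · simp only [Fin.sum_univ_eight]
    simp [degMoment_zero, hdm, polyA, polyB]
    field_simp
    ring
  all_goals
    intro i
    simp only [Fin.sum_univ_eight, hg, hq, hr, ht]
    simp
    ring

/-! ### The configuration model as a counting measure -/

theorem integral_CM {n : ℕ} {d : Fin n → ℕ} (f : Pairing d → ℝ) :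
    ∫ σ, f σ ∂(CM d) = (∑ σ, f σ) / Fintype.card (Pairing d) := by
  rw [CM, uniformOn, ProbabilityTheory.cond, integral_smul_measure, Measure.restrict_univ,
    integral_fintype (Integrable.of_finite)]
  simp [Measure.real, div_eq_inv_mul]

theorem CM_real_apply {n : ℕ} {d : Fin n → ℕ} (P : Pairing d → Prop) :
    (CM d).real {σ | P σ} = Pairing.count P / Fintype.card (Pairing d) := by
  classical
  rw [Measure.real, CM, uniformOn_univ, ENNReal.toReal_div,
    Measure.count_apply_finite _ (Set.toFinite _)]
  simp [Pairing.count]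

theorem isProbabilityMeasure_CM {n : ℕ} {d : Fin n → ℕ} (h : Even (∑ i, d i)) :
    IsProbabilityMeasure (CM d) := by
  have := Pairing.nonempty_of_even h
  exact isProbabilityMeasure_uniformOn Set.finite_univ Set.univ_nonempty

/-- The expected bias of the configuration model. -/
theorem expected_TFB {n : ℕ} {d : Fin n → ℕ} (hd : ∀ i, 0 < d i) (he : Even (∑ i, d i))
    (hm : 7 < degMoment d 1) :
    ∫ σ, TFB σ.adj ∂(CM d) =
      1 / (2 * (degMoment d 1 - 1) * (degMoment d 1 - 3) * (degMoment d 1 - 5)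
        * (degMoment d 1 - 7)) * (polyA (degMoment d) / n + polyB (degMoment d)) := by
  have hne := Pairing.nonempty_of_even he
  have hn : (n : ℝ) ≠ 0 := by
    rintro h
    obtain rfl : n = 0 := by exact_mod_cast h
    simp [degMoment] at hm
    norm_num at hm
  have hc : (Fintype.card (Pairing d) : ℝ) ≠ 0 := Nat.cast_ne_zero.2 Fintype.card_ne_zero
  have h := Pairing.sum_card_mul_TFB hd (by rwa [← degMoment_one])
  rw [← degMoment_one, sum_triangleBias hd rfl hm, ← Finset.mul_sum] at h
  rw [integral_CM, div_eq_iff hc, ← mul_right_inj' hn, h]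
  field_simp

/-! ### Inequalities between degree moments -/

theorem fractionOf_eq_sum {n : ℕ} (d : Fin n → ℕ) (p : ℕ → Prop) [DecidablePred p] :
    fractionOf d p = (∑ i, if p (d i) then (1 : ℝ) else 0) / n := by
  rw [fractionOf, Nat.card_eq_fintype_card, Fintype.card_subtype]
  simp

theorem fractionOf_nonneg {n : ℕ} (d : Fin n → ℕ) (p : ℕ → Prop) : 0 ≤ fractionOf d p := by
  unfold fractionOf
  positivity

theorem sum_sum_sq_sub {n : ℕ} (d : Fin n → ℕ) :
    ∑ i, ∑ j, ((d i : ℝ) - d j) ^ 2 = 2 * (n * degMoment d 2 - degMoment d 1 ^ 2) := by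
  have h : ∀ i j, ((d i : ℝ) - d j) ^ 2 =
      (d i : ℝ) ^ 2 * 1 - 2 * ((d i : ℝ) ^ 1 * (d j : ℝ) ^ 1) + 1 * (d j : ℝ) ^ 2 := by
    intros; ring
  simp only [h, Finset.sum_add_distrib, Finset.sum_sub_distrib, ← Finset.mul_sum, ← Finset.sum_mul]
  simp [degMoment]
  ring

/-- Twice `n ^ 2` times the empirical covariance of `d` and `d (d - 3)` as a sum over pairs. -/
theorem sum_sum_sq_sub_mul {n : ℕ} (d : Fin n → ℕ) :
    ∑ i, ∑ j, ((d i : ℝ) - d j) ^ 2 * (d i + d j - 3) =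
      2 * (n * degMoment d 3 - degMoment d 1 * degMoment d 2)
        - 6 * (n * degMoment d 2 - degMoment d 1 ^ 2) := by
  have h : ∀ i j, ((d i : ℝ) - d j) ^ 2 * (d i + d j - 3) =
      (d i : ℝ) ^ 3 * 1 - (d i : ℝ) ^ 1 * (d j : ℝ) ^ 2 - (d i : ℝ) ^ 2 * (d j : ℝ) ^ 1
        + 1 * (d j : ℝ) ^ 3 - 3 * ((d i : ℝ) - d j) ^ 2 := by
    intros; ring
  simp only [h, Finset.sum_add_distrib, Finset.sum_sub_distrib, ← Finset.mul_sum, ← Finset.sum_mul,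
    sum_sum_sq_sub]
  simp [degMoment]
  ring

/-- The empirical covariance of `d` and `d (d - 3)` is non-negative, since `x (x - 3)` is monotone
on the positive integers, and it controls the empirical variance of `d` unless few of the values
are at least `3`. -/
theorem fractionOf_mul_variance_le {n : ℕ} (hn : 0 < n) (d : Fin n → ℕ) (hd : ∀ i, 0 < d i) :
    0 ≤ degMoment d 2 / n - (degMoment d 1 / n) ^ 2 ∧
    0 ≤ degMoment d 3 / n - degMoment d 1 / n * (degMoment d 2 / n)
        - 3 * (degMoment d 2 / n - (degMoment d 1 / n) ^ 2) ∧
    fractionOf d (fun x => 3 ≤ x) * (degMoment d 2 / n - (degMoment d 1 / n) ^ 2) ≤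
      2 * (degMoment d 3 / n - degMoment d 1 / n * (degMoment d 2 / n)
        - 3 * (degMoment d 2 / n - (degMoment d 1 / n) ^ 2)) := by
  have hn' : (0 : ℝ) < n := by exact_mod_cast hn
  set V := ∑ i, ∑ j, ((d i : ℝ) - d j) ^ 2 with hV
  set K := ∑ i, ∑ j, ((d i : ℝ) - d j) ^ 2 * (d i + d j - 3) with hK
  set big : Fin n → ℝ := fun i => if 3 ≤ d i then 1 else 0 with hbig
  set q := ∑ i, big i with hq
  have hV0 : 0 ≤ V := Finset.sum_nonneg fun i _ => Finset.sum_nonneg fun j _ => sq_nonneg _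
  -- distinct degrees add up to at least `3`
  have hcases : ∀ i j, d i = d j ∨ (d i ≠ d j ∧ d i ≤ 2 ∧ d j ≤ 2 ∧ d i + d j = 3) ∨
      (d i ≠ d j ∧ 4 ≤ d i + d j) := fun i j => by
    have := hd i
    have := hd j
    omega
  have hsq : ∀ i j, d i ≠ d j → 1 ≤ ((d i : ℝ) - d j) ^ 2 := fun i j h => by
    have h' : (1 : ℤ) ≤ |(d i : ℤ) - d j| := Int.one_le_abs (by omega)
    have h2 : (1 : ℤ) ≤ ((d i : ℤ) - d j) ^ 2 := by
      rw [← sq_abs]; nlinarith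
    exact_mod_cast h2
  have hK1 : ∀ i j, 0 ≤ ((d i : ℝ) - d j) ^ 2 * (d i + d j - 3) := fun i j => by
    rcases hcases i j with h | ⟨-, -, -, h⟩ | ⟨-, h⟩
    · simp [h]
    · have : (d i + d j : ℝ) = 3 := by exact_mod_cast h
      simp [this]
    · have : (4 : ℝ) ≤ d i + d j := by exact_mod_cast h
      exact mul_nonneg (sq_nonneg _) (by linarith)
  have hK0 : 0 ≤ K := Finset.sum_nonneg fun i _ => Finset.sum_nonneg fun j _ => hK1 i j
  have hK2 : ∀ i j, big i * (1 - big j) ≤ ((d i : ℝ) - d j) ^ 2 * (d i + d j - 3) := fun i j => by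
    by_cases hi : 3 ≤ d i
    · by_cases hj : 3 ≤ d j
      · simpa [hbig, hi, hj] using hK1 i j
      · have h1 := hsq i j (by omega)
        have h2 := hd j
        have h3 : (4 : ℝ) ≤ d i + d j := by exact_mod_cast (by omega : 4 ≤ d i + d j)
        simp only [hbig, hi, hj, if_true, if_false]
        nlinarith
    · simpa [hbig, hi] using hK1 i j
  have hVK : ∀ i j, ((d i : ℝ) - d j) ^ 2 ≤
      ((d i : ℝ) - d j) ^ 2 * (d i + d j - 3) + (1 - big i) * (1 - big j) := fun i j => by
    have hb : ∀ i, 0 ≤ 1 - big i := fun i => by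
      simp only [hbig]; split_ifs <;> norm_num
    rcases hcases i j with h | ⟨-, h1, h2, h⟩ | ⟨-, h⟩
    · simpa [h] using mul_nonneg (hb i) (hb j)
    · have hi : ¬ 3 ≤ d i := by omega
      have hj : ¬ 3 ≤ d j := by omega
      have : (d j : ℝ) = 3 - d i := by
        have : (d i + d j : ℝ) = 3 := by exact_mod_cast h
        linarith
      simp only [hbig, hi, hj, if_false, this]
      have h12 : d i = 1 ∨ d i = 2 := by
        have := hd i
        omega
      rcases h12 with h | h <;> rw [h] <;> norm_num
    · have : (4 : ℝ) ≤ d i + d j := by exact_mod_cast h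
      nlinarith [mul_nonneg (hb i) (hb j), sq_nonneg ((d i : ℝ) - d j)]
  have hs : ∑ j, (1 - big j) = n - q := by simp [hq]
  have hqK : q * (n - q) ≤ K := by
    rw [← hs, hq, Finset.sum_mul_sum]
    exact Finset.sum_le_sum fun i _ => Finset.sum_le_sum fun j _ => hK2 i j
  have hVK' : V ≤ K + (n - q) * (n - q) := by
    rw [← hs, Finset.sum_mul_sum, hK, ← Finset.sum_add_distrib]
    refine Finset.sum_le_sum fun i _ => ?_
    rw [← Finset.sum_add_distrib]
    exact Finset.sum_le_sum fun j _ => hVK i j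
  have hq0 : 0 ≤ q := Finset.sum_nonneg fun i _ => by
    simp only [hbig]; split_ifs <;> norm_num
  have hqn : 0 ≤ n - q := by
    rw [← hs]
    refine Finset.sum_nonneg fun i _ => ?_
    simp only [hbig]; split_ifs <;> norm_num
  have hqV : q * V ≤ 2 * n * K := by
    have h1 : q * V ≤ q * (K + (n - q) * (n - q)) := mul_le_mul_of_nonneg_left hVK' hq0
    have h2 : q * K ≤ n * K := mul_le_mul_of_nonneg_right (by linarith) hK0
    have h3 : q * (n - q) * (n - q) ≤ K * n := mul_le_mul hqK (by linarith) hqn hK0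
    linarith
  have eV : degMoment d 2 / n - (degMoment d 1 / n) ^ 2 = V / (2 * n ^ 2) := by
    rw [hV, sum_sum_sq_sub]
    field_simp
  have eK : degMoment d 3 / n - degMoment d 1 / n * (degMoment d 2 / n)
        - 3 * (degMoment d 2 / n - (degMoment d 1 / n) ^ 2) = K / (2 * n ^ 2) := by
    rw [hK, sum_sum_sq_sub_mul]
    field_simp
    ring
  rw [eK, eV, fractionOf_eq_sum]
  refine ⟨by positivity, by positivity, ?_⟩
  change q / n * _ ≤ _
  rw [div_mul_div_comm, mul_div_assoc', div_le_div_iff₀ (by positivity) (by positivity)]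
  have := mul_le_mul_of_nonneg_right hqV (by positivity : (0 : ℝ) ≤ 2 * (n : ℝ) ^ 2)
  linarith

theorem sum_pow_mul_sq {n : ℕ} (d : Fin n → ℕ) (D : ℝ) (j : ℕ) :
    ∑ i, (d i : ℝ) ^ j * ((d i : ℝ) - D) ^ 2 =
      degMoment d (j + 2) - 2 * D * degMoment d (j + 1) + D ^ 2 * degMoment d j := by
  simp only [degMoment, Finset.mul_sum, ← Finset.sum_sub_distrib, ← Finset.sum_add_distrib]
  exact Finset.sum_congr rfl fun i _ => by ring

/-- The Cauchy-Schwarz inequality for the weighted quadratic deviations of the degrees. -/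
theorem sum_pow_mul_sq_sq_le {n : ℕ} (d : Fin n → ℕ) (D : ℝ) (j : ℕ) :
    (∑ i, (d i : ℝ) ^ (j + 1) * ((d i : ℝ) - D) ^ 2) ^ 2 ≤
      (∑ i, (d i : ℝ) ^ j * ((d i : ℝ) - D) ^ 2) *
        ∑ i, (d i : ℝ) ^ (j + 2) * ((d i : ℝ) - D) ^ 2 :=
  Finset.sum_sq_le_sum_mul_sum_of_sq_le_mul _ (fun i _ => by positivity) (fun i _ => by positivity)
    fun i _ => le_of_eq (by ring)

/-! ### Limits of the degree moments -/

section Limits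

variable {N : ℕ → ℕ} {d : ∀ r, Fin (N r) → ℕ} {c : ℕ → ℝ}

theorem tendsto_sum_pow_mul_sq
    (hc : ∀ k ≤ 7, Tendsto (fun r => degMoment (d r) k / (N r : ℝ)) atTop (𝓝 (c k)))
    (D : ℝ) {j : ℕ} (hj : j ≤ 5) :
    Tendsto (fun r => (∑ i, (d r i : ℝ) ^ j * ((d r i : ℝ) - D) ^ 2) / (N r : ℝ)) atTop
      (𝓝 (c (j + 2) - 2 * D * c (j + 1) + D ^ 2 * c j)) := by
  refine ((((hc (j + 2) (by omega))).sub ((hc (j + 1) (by omega)).const_mul (2 * D))).add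
    ((hc j (by omega)).const_mul (D ^ 2))).congr fun r => ?_
  rw [sum_pow_mul_sq]
  ring

theorem moments_eq_pow_of_variance_eq_zero
    (hc : ∀ k ≤ 7, Tendsto (fun r => degMoment (d r) k / (N r : ℝ)) atTop (𝓝 (c k)))
    (h0 : c 0 = 1) (hvar : c 2 = c 1 ^ 2) : ∀ k ≤ 6, c k = c 1 ^ k := by
  -- by Cauchy-Schwarz, all weighted quadratic deviations from `c 1` vanish in the limit
  have hdev : ∀ j ≤ 4, c (j + 2) - 2 * c 1 * c (j + 1) + c 1 ^ 2 * c j = 0 := by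
    intro j
    induction j with
    | zero =>
      intro _
      rw [h0, hvar]
      ring
    | succ j ih =>
      intro hj
      have h1 := tendsto_sum_pow_mul_sq hc (c 1) (j := j) (by omega)
      have h2 := tendsto_sum_pow_mul_sq hc (c 1) (j := j + 1) (by omega)
      have h3 := tendsto_sum_pow_mul_sq hc (c 1) (j := j + 2) (by omega)
      have hle := le_of_tendsto_of_tendsto' (h2.pow 2) (h1.mul h3) fun r => by
        rw [div_pow, div_mul_div_comm, ← sq]
        exact div_le_div_of_nonneg_right (sum_pow_mul_sq_sq_le _ _ _) (by positivity)
      rw [ih (by omega), zero_mul] at hle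
      exact pow_eq_zero_iff two_ne_zero |>.1 (le_antisymm hle (sq_nonneg _))
  intro k
  induction k using Nat.strong_induction_on with
  | _ k ih =>
    intro hk
    match k with
    | 0 => simpa using h0
    | 1 => simp
    | k + 2 =>
      have h1 := hdev k (by omega)
      rw [ih k (by omega) (by omega), ih (k + 1) (by omega) (by omega)] at h1
      linear_combination h1

theorem variance_eq_zero_iff_regular (hN : Tendsto N atTop atTop)
    (hc : ∀ k ≤ 7, Tendsto (fun r => degMoment (d r) k / (N r : ℝ)) atTop (𝓝 (c k)))
    (h0 : c 0 = 1) (h1 : 0 < c 1) :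
    c 2 = c 1 ^ 2 ↔ ∃ D : ℕ, 1 ≤ D ∧
      Tendsto (fun r => fractionOf (d r) (fun x => x ≠ D)) atTop (𝓝 0) ∧
      ∀ k, 1 ≤ k → k ≤ 6 → c k = (D : ℝ) ^ k := by
  constructor
  · intro hvar
    have hdev := tendsto_sum_pow_mul_sq hc (c 1) (j := 0) (by omega)
    have hz : c (0 + 2) - 2 * c 1 * c (0 + 1) + c 1 ^ 2 * c 0 = 0 := by
      rw [h0, zero_add, zero_add, hvar]
      ring
    rw [hz] at hdev
    simp only [pow_zero, one_mul] at hdev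
    -- the mean is an integer, as the integers concentrate at it
    have hround : (c 1 - round (c 1)) ^ 2 ≤ 0 := by
      refine ge_of_tendsto hdev ?_
      filter_upwards [hN.eventually_gt_atTop 0] with r hr
      have hr' : (0 : ℝ) < N r := by exact_mod_cast hr
      rw [le_div_iff₀ hr']
      calc (c 1 - round (c 1)) ^ 2 * N r = ∑ i : Fin (N r), (c 1 - round (c 1)) ^ 2 := by
            simp [mul_comm]
        _ ≤ _ := Finset.sum_le_sum fun i _ => by
            rw [sub_sq_comm (d r i : ℝ) (c 1)]
            exact sq_le_sq.2 (by simpa using round_le (c 1) (d r i))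
    have hround' : c 1 = round (c 1) :=
      sub_eq_zero.1 (pow_eq_zero_iff two_ne_zero |>.1 (le_antisymm hround (sq_nonneg _)))
    have hpos : 0 < round (c 1) := by
      rw [hround'] at h1
      exact_mod_cast h1
    obtain ⟨D, hD⟩ := Int.eq_ofNat_of_zero_le hpos.le
    have hcD : c 1 = D := by rw [hround', hD]; simp
    refine ⟨D, by omega, ?_, fun k _ hk => ?_⟩
    · refine squeeze_zero (fun r => fractionOf_nonneg _ _) (fun r => ?_) hdev
      rw [fractionOf_eq_sum]
      refine div_le_div_of_nonneg_right (Finset.sum_le_sum fun i _ => ?_) (by positivity)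
      split_ifs with h
      · have h' : (1 : ℤ) ≤ |(d r i : ℤ) - D| := Int.one_le_abs (by omega)
        have h2 : (1 : ℤ) ≤ ((d r i : ℤ) - D) ^ 2 := by
          rw [← sq_abs]; nlinarith
        rw [hcD]
        exact_mod_cast h2
      · positivity
    · rw [moments_eq_pow_of_variance_eq_zero hc h0 hvar k hk, hcD]
  · rintro ⟨D, -, -, h⟩
    rw [h 1 le_rfl (by omega), h 2 (by omega) (by omega)]
    ring

theorem tendsto_sum_sub_one_sub_two
    (hc : ∀ k ≤ 7, Tendsto (fun r => degMoment (d r) k / (N r : ℝ)) atTop (𝓝 (c k))) :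
    Tendsto (fun r => (∑ i, ((d r i : ℝ) - 1) * (d r i - 2)) / (N r : ℝ)) atTop
        (𝓝 (c 2 - 3 * c 1 + 2 * c 0)) ∧
      Tendsto (fun r => (∑ i, (d r i : ℝ) * (d r i - 1) * (d r i - 2)) / (N r : ℝ)) atTop
        (𝓝 (c 3 - 3 * c 2 + 2 * c 1)) := by
  constructor
  · refine (((hc 2 (by omega)).sub ((hc 1 (by omega)).const_mul 3)).add
      ((hc 0 (by omega)).const_mul 2)).congr fun r => ?_
    rw [sum_eq_degMoment (d r) ![2, -3, 1, 0, 0, 0, 0, 0] fun i => by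
      simp [Fin.sum_univ_eight]; ring]
    simp [Fin.sum_univ_eight]
    ring
  · refine (((hc 3 (by omega)).sub ((hc 2 (by omega)).const_mul 3)).add
      ((hc 1 (by omega)).const_mul 2)).congr fun r => ?_
    rw [sum_eq_degMoment (d r) ![0, 2, -3, 1, 0, 0, 0, 0] fun i => by
      simp [Fin.sum_univ_eight]; ring]
    simp [Fin.sum_univ_eight]
    ring

/-- If almost all degrees are `1` or `2`, then so is the limiting degree; this forces the
covariance of the degree `X` and `X (X - 3)` to vanish. -/
theorem covariance_eq_zero_of_tendsto
    (hd : ∀ r i, 0 < d r i)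
    (hc : ∀ k ≤ 7, Tendsto (fun r => degMoment (d r) k / (N r : ℝ)) atTop (𝓝 (c k)))
    (h0 : c 0 = 1)
    (h : Tendsto (fun r => fractionOf (d r) (fun x => 3 ≤ x)) atTop (𝓝 0)) :
    (c 3 - c 1 * c 2) - 3 * (c 2 - c 1 ^ 2) = 0 := by
  obtain ⟨hB, hC⟩ := tendsto_sum_sub_one_sub_two hc
  have hpoly : ∀ r i, 0 ≤ ((d r i : ℝ) - 1) * (d r i - 2) := fun r i => by
    have h1 := hd r i
    rcases (by omega : d r i = 1 ∨ d r i = 2 ∨ 3 ≤ d r i) with h | h | h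
    · simp [h]
    · simp [h]
    · have : (3 : ℝ) ≤ d r i := by exact_mod_cast h
      exact mul_nonneg (by linarith) (by linarith)
  have hB0 : 0 ≤ c 2 - 3 * c 1 + 2 * c 0 :=
    ge_of_tendsto' hB fun r => div_nonneg (Finset.sum_nonneg fun i _ => hpoly r i) (by positivity)
  have hBC : c 2 - 3 * c 1 + 2 * c 0 ≤ c 3 - 3 * c 2 + 2 * c 1 :=
    le_of_tendsto_of_tendsto' hB hC fun r =>
      div_le_div_of_nonneg_right (Finset.sum_le_sum fun i _ => by
        have h1 : (1 : ℝ) ≤ d r i := by exact_mod_cast hd r i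
        nlinarith [hpoly r i]) (by positivity)
  have hC0 : (c 3 - 3 * c 2 + 2 * c 1) ^ 2 ≤ 0 * c 6 := by
    refine le_of_tendsto_of_tendsto' (hC.pow 2) (h.mul (hc 6 (by omega))) fun r => ?_
    rw [fractionOf_eq_sum, div_pow, div_mul_div_comm, ← sq]
    refine div_le_div_of_nonneg_right ?_ (by positivity)
    have hsupp : ∑ i, (d r i : ℝ) * (d r i - 1) * (d r i - 2) =
        ∑ i, (if 3 ≤ d r i then (1 : ℝ) else 0) * ((d r i : ℝ) * (d r i - 1) * (d r i - 2)) := by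
      refine Finset.sum_congr rfl fun i _ => ?_
      have h1 := hd r i
      rcases (by omega : d r i = 1 ∨ d r i = 2 ∨ 3 ≤ d r i) with h | h | h <;> simp [h]
    rw [hsupp]
    refine (Finset.sum_mul_sq_le_sq_mul_sq _ _ _).trans ?_
    refine mul_le_mul (Finset.sum_le_sum fun i _ => ?_) (Finset.sum_le_sum fun i _ => ?_)
      (Finset.sum_nonneg fun i _ => sq_nonneg _) (Finset.sum_nonneg fun i _ => ?_)
    · split_ifs <;> norm_num
    · have h1 : (1 : ℝ) ≤ d r i := by exact_mod_cast hd r i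
      have h2 := hpoly r i
      have h3 : ((d r i : ℝ) - 1) * (d r i - 2) ≤ (d r i : ℝ) ^ 2 := by nlinarith
      calc ((d r i : ℝ) * (d r i - 1) * (d r i - 2)) ^ 2
          = (d r i : ℝ) ^ 2 * (((d r i : ℝ) - 1) * (d r i - 2)) ^ 2 := by ring
        _ ≤ (d r i : ℝ) ^ 2 * ((d r i : ℝ) ^ 2) ^ 2 := by gcongr
        _ = (d r i : ℝ) ^ 6 := by ring
    · split_ifs <;> norm_num
  rw [zero_mul] at hC0
  have hC' := pow_eq_zero_iff two_ne_zero |>.1 (le_antisymm hC0 (sq_nonneg _))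
  have hB' := le_antisymm (hBC.trans hC'.le) hB0
  rw [h0] at hB'
  linear_combination hC' - c 1 * hB'

theorem zeta_nonneg_and_eq_zero_iff (hN : Tendsto N atTop atTop)
    (hd : ∀ r i, 0 < d r i)
    (hc : ∀ k ≤ 7, Tendsto (fun r => degMoment (d r) k / (N r : ℝ)) atTop (𝓝 (c k)))
    (h0 : c 0 = 1) (h1 : 0 < c 1) :
    0 ≤ zeta (c 1) (c 2) (c 3) ∧
      (zeta (c 1) (c 2) (c 3) = 0 ↔ c 2 = c 1 ^ 2 ∨
        Tendsto (fun r => fractionOf (d r) (fun x => 3 ≤ x)) atTop (𝓝 0)) := by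
  have hvar := (hc 2 (by omega)).sub ((hc 1 (by omega)).pow 2)
  have hcov := ((hc 3 (by omega)).sub ((hc 1 (by omega)).mul (hc 2 (by omega)))).sub
    (hvar.const_mul 3)
  have hev : ∀ᶠ r in atTop, 0 < N r := hN.eventually_gt_atTop 0
  have hcov0 : 0 ≤ (c 3 - c 1 * c 2) - 3 * (c 2 - c 1 ^ 2) :=
    ge_of_tendsto hcov (hev.mono fun r hr => (fractionOf_mul_variance_le hr (d r) (hd r)).2.1)
  refine ⟨mul_nonneg (by positivity) hcov0, ⟨fun hz => ?_, fun h => ?_⟩⟩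
  · rw [or_iff_not_imp_left]
    intro hne
    rw [zeta, mul_eq_zero, div_eq_zero_iff] at hz
    rcases hz with (hz | hz) | hz
    · -- here `c 2 = c 1`, so almost all degrees are `1`
      have h21 : c 2 - c 1 = 0 := pow_eq_zero_iff two_ne_zero |>.1 hz
      have hlim := (hc 2 (by omega)).sub (hc 1 (by omega))
      rw [h21] at hlim
      refine squeeze_zero (fun r => fractionOf_nonneg _ _) (fun r => ?_) hlim
      rw [fractionOf_eq_sum, ← sub_div, degMoment, degMoment, ← Finset.sum_sub_distrib]
      refine div_le_div_of_nonneg_right (Finset.sum_le_sum fun i _ => ?_) (by positivity)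
      have h1 : (1 : ℝ) ≤ d r i := by exact_mod_cast hd r i
      split_ifs with h
      · have : (3 : ℝ) ≤ d r i := by exact_mod_cast h
        nlinarith
      · nlinarith
    · exact absurd hz (by positivity)
    · rw [hz] at hcov
      have hv0 : 0 < c 2 - c 1 ^ 2 := lt_of_le_of_ne
        (ge_of_tendsto hvar (hev.mono fun r hr => (fractionOf_mul_variance_le hr (d r) (hd r)).1))
        (fun h => hne (sub_eq_zero.1 h.symm))
      have hprod : Tendsto (fun r => fractionOf (d r) (fun x => 3 ≤ x) *
          (degMoment (d r) 2 / N r - (degMoment (d r) 1 / N r) ^ 2)) atTop (𝓝 0) := by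
        refine squeeze_zero' (hev.mono fun r hr => mul_nonneg (fractionOf_nonneg _ _)
          (fractionOf_mul_variance_le hr (d r) (hd r)).1) (hev.mono fun r hr =>
          (fractionOf_mul_variance_le hr (d r) (hd r)).2.2) ?_
        simpa using hcov.const_mul 2
      have hquot := hprod.div hvar hv0.ne'
      rw [zero_div] at hquot
      refine hquot.congr' ?_
      filter_upwards [hvar.eventually_ne hv0.ne'] with r hr
      exact mul_div_cancel_right₀ _ hr
  · have : (c 3 - c 1 * c 2) - 3 * (c 2 - c 1 ^ 2) = 0 := by
      rcases h with h | h
      · have hpow := moments_eq_pow_of_variance_eq_zero hc h0 h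
        rw [hpow 2 (by omega), hpow 3 (by omega)]
        ring
      · exact covariance_eq_zero_of_tendsto hd hc h0 h
    rw [zeta, this, mul_zero]

end Limits

/-! ### The limit of the expected bias -/

/-- The numerator of the expected total bias divided by `n ^ 4`, as a function of `e = 1 / n` and
of the empirical moments `x k`. -/
def scaledNumerator (e : ℝ) (x : Fin 8 → ℝ) : ℝ :=
  e ^ 2 * (6 * x 1 * x 3 - 18 * x 1 * x 4 + 14 * x 1 * x 5 - 2 * x 1 * x 6 + 4 * x 2 * x 3
      - 8 * x 2 * x 4 + 4 * x 3 ^ 2)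
    + e * (-14 * x 1 * x 2 * x 3 + 3 * x 1 * x 2 * x 4 - 9 * x 1 ^ 2 * x 2 + 18 * x 1 ^ 2 * x 3
      - 5 * x 1 ^ 2 * x 4 + 3 * x 1 * x 2 ^ 2 + 4 * x 2 ^ 3)
    + (-7 * x 1 ^ 3 * x 2 - x 1 * x 2 ^ 3 + 5 * x 1 ^ 2 * x 2 ^ 2 + 3 * x 1 ^ 4)
    + e ^ 2 * (2 * x 7 - 10 * x 6 + 14 * x 5 - 6 * x 4)
    + e * (6 * x 1 * x 3 - 8 * x 1 * x 4 + 2 * x 1 * x 5 - 13 * x 2 * x 3 + 11 * x 2 * x 4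
      - 2 * x 2 * x 5 - x 3 * x 4 + 3 * x 2 ^ 2 + 2 * x 3 ^ 2)
    + (-2 * x 1 * x 2 * x 3 - 3 * x 1 ^ 2 * x 2 + x 1 ^ 2 * x 3 + 6 * x 1 * x 2 ^ 2
      + x 2 ^ 2 * x 3 - 3 * x 2 ^ 3)

theorem polyA_add_mul_polyB {n : ℝ} (hn : n ≠ 0) (m : ℕ → ℝ) :
    polyA m + n * polyB m = n ^ 4 * scaledNumerator (1 / n) fun k => m k / n := by
  simp [polyA, polyB, scaledNumerator]
  field_simp
  ring

theorem one_le_degMoment_div {n : ℕ} (hn : 0 < n) {d : Fin n → ℕ} (hd : ∀ i, 0 < d i) :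
    (1 : ℝ) ≤ degMoment d 1 / n := by
  rw [le_div_iff₀ (by exact_mod_cast hn), one_mul]
  calc (n : ℝ) = ∑ i : Fin n, (1 : ℝ) := by simp
    _ ≤ degMoment d 1 := Finset.sum_le_sum fun i _ => by
      rw [pow_one]
      exact_mod_cast hd i

theorem tendsto_expected_TFB {N : ℕ → ℕ} {d : ∀ r, Fin (N r) → ℕ} {c : ℕ → ℝ}
    (hN : Tendsto N atTop atTop) (hd : ∀ r i, 0 < d r i) (he : ∀ r, Even (∑ i, d r i))
    (hc : ∀ k ≤ 7, Tendsto (fun r => degMoment (d r) k / (N r : ℝ)) atTop (𝓝 (c k)))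
    (h1 : 0 < c 1) :
    Tendsto (fun r => ∫ σ, (N r : ℝ) * TFB σ.adj ∂(CM (d r))) atTop
      (𝓝 (zeta (c 1) (c 2) (c 3))) := by
  have hinv : Tendsto (fun r => 1 / (N r : ℝ)) atTop (𝓝 0) :=
    tendsto_one_div_atTop_nhds_zero_nat.comp hN
  have hx : Tendsto (fun r => (1 / (N r : ℝ), fun k : Fin 8 => degMoment (d r) k / (N r : ℝ))) atTop
      (𝓝 ((0 : ℝ), fun k : Fin 8 => c k)) :=
    hinv.prodMk_nhds (tendsto_pi_nhds.2 fun k => hc k (by omega))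
  have hnum : Continuous fun p : ℝ × (Fin 8 → ℝ) => scaledNumerator p.1 p.2 := by
    unfold scaledNumerator
    fun_prop
  have hden : Continuous fun p : ℝ × (Fin 8 → ℝ) =>
      2 * (p.2 1 - p.1) * (p.2 1 - 3 * p.1) * (p.2 1 - 5 * p.1) * (p.2 1 - 7 * p.1) := by
    fun_prop
  have hlim := ((hnum.tendsto _).comp hx).div ((hden.tendsto _).comp hx) (by
    simp [h1.ne'])
  have hzeta : scaledNumerator 0 (fun k : Fin 8 => c k) /
      (2 * (c 1 - 0) * (c 1 - 3 * 0) * (c 1 - 5 * 0) * (c 1 - 7 * 0)) =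
        zeta (c 1) (c 2) (c 3) := by
    simp [scaledNumerator, zeta]
    field_simp
    ring
  rw [← hzeta]
  refine hlim.congr' ?_
  filter_upwards [hN.eventually_gt_atTop 7] with r hr
  have hn : (N r : ℝ) ≠ 0 := by
    have : N r ≠ 0 := by omega
    exact_mod_cast this
  have hm : 7 < degMoment (d r) 1 := by
    have h := one_le_degMoment_div (by omega) (hd r)
    rw [le_div_iff₀ (by exact_mod_cast (by omega : 0 < N r))] at h
    have : (7 : ℝ) < N r := by exact_mod_cast hr
    linarith
  have hD : ∀ t : ℝ, degMoment (d r) 1 - t =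
      N r * (degMoment (d r) 1 / N r - t * (1 / N r)) := fun t => by
    field_simp
  rw [integral_const_mul, expected_TFB (hd r) (he r) hm]
  have e : (N r : ℝ) * (1 / (2 * (degMoment (d r) 1 - 1) * (degMoment (d r) 1 - 3) *
      (degMoment (d r) 1 - 5) * (degMoment (d r) 1 - 7)) *
        (polyA (degMoment (d r)) / N r + polyB (degMoment (d r)))) =
      (polyA (degMoment (d r)) + N r * polyB (degMoment (d r))) /
        (2 * (degMoment (d r) 1 - 1) * (degMoment (d r) 1 - 3) *
      (degMoment (d r) 1 - 5) * (degMoment (d r) 1 - 7)) := by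
    rw [one_div_mul_eq_div, ← mul_div_assoc, mul_add, mul_div_cancel₀ _ hn]
  rw [e, polyA_add_mul_polyB hn, hD 1, hD 3, hD 5, hD 7]
  have e2 : ∀ a b c d n : ℝ, 2 * (n * a) * (n * b) * (n * c) * (n * d) =
      n ^ 4 * (2 * a * b * c * d) := by
    intros; ring
  rw [e2, mul_div_mul_left _ _ (pow_ne_zero 4 hn), one_mul]
  rfl

/-! ### The lopsided local lemma -/

section LocalLemma

variable {Ω ι : Type*}

/-- The event that none of the events `A f` with `f ∈ S` occurs. -/
def avoid (A : ι → Set Ω) (S : Finset ι) : Set Ω := {ω | ∀ f ∈ S, ω ∉ A f}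

theorem avoid_anti (A : ι → Set Ω) {S T : Finset ι} (h : S ⊆ T) : avoid A T ⊆ avoid A S :=
  fun _ hω f hf => hω f (h hf)

/-- The inductive step of the symmetric lopsided local lemma. Instead of independence, only
`P(A e ∣ avoid S) ≤ p` is assumed, for sets `S` of non-neighbours of `e`. -/
theorem measureReal_inter_avoid_le [MeasurableSpace Ω] (μ : Measure Ω) [IsFiniteMeasure μ]
    (A : ι → Set Ω) (I : Finset ι) (nbr : ι → ι → Prop) [∀ e, DecidablePred (nbr e)] {p : ℝ}
    (hp : 0 ≤ p)
    (hneg : ∀ e ∈ I, ∀ S ⊆ I, (∀ f ∈ S, ¬ nbr e f) →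
      μ.real (A e ∩ avoid A S) ≤ p * μ.real (avoid A S))
    (hdeg : ∀ e ∈ I, ((I.filter (nbr e)).card : ℝ) * p ≤ 1 / 4) :
    ∀ S ⊆ I, ∀ e ∈ I, μ.real (A e ∩ avoid A S) ≤ 2 * p * μ.real (avoid A S) := by
  intro S
  induction S using Finset.strongInduction with
  | H S ih =>
    intro hS e he
    set S₁ := S.filter (nbr e) with hS₁
    set S₂ := S.filter (fun f => ¬ nbr e f) with hS₂
    have hsub : S₂ ⊆ S := Finset.filter_subset _ _
    have hneg₂ : μ.real (A e ∩ avoid A S₂) ≤ p * μ.real (avoid A S₂) :=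
      hneg e he S₂ (hsub.trans hS) fun f hf => (Finset.mem_filter.1 hf).2
    -- avoiding `S₂`, the events in `S₁` together have conditional probability at most `1 / 2`
    have hhalf : μ.real (avoid A S₂) ≤ 2 * μ.real (avoid A S) := by
      rcases S₁.eq_empty_or_nonempty with h | ⟨g, hg⟩
      · have : S₂ = S := Finset.filter_true_of_mem fun f hf hn =>
          Finset.notMem_empty f (h ▸ Finset.mem_filter.2 ⟨hf, hn⟩)
        rw [this]
        linarith [measureReal_nonneg (μ := μ) (s := avoid A S)]
      · have hlt : S₂ ⊂ S := Finset.filter_ssubset.2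
          ⟨g, (Finset.mem_filter.1 hg).1, not_not.2 (Finset.mem_filter.1 hg).2⟩
        have hcover : avoid A S₂ ⊆ avoid A S ∪ ⋃ f ∈ S₁, A f ∩ avoid A S₂ := by
          intro ω hω
          by_cases h : ω ∈ avoid A S
          · exact Or.inl h
          · simp only [avoid, Set.mem_ofPred_eq, not_forall, not_not] at h
            obtain ⟨f, hf, hA⟩ := h
            refine Or.inr (Set.mem_biUnion (x := f) ?_ ⟨hA, hω⟩)
            refine Finset.mem_filter.2 ⟨hf, ?_⟩
            by_contra hn
            exact hω f (Finset.mem_filter.2 ⟨hf, hn⟩) hA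
        have hsum : ∑ f ∈ S₁, μ.real (A f ∩ avoid A S₂) ≤
            ∑ f ∈ S₁, 2 * p * μ.real (avoid A S₂) := Finset.sum_le_sum fun f hf =>
          ih S₂ hlt (hsub.trans hS) f (hS (Finset.mem_filter.1 hf).1)
        have hcard : (S₁.card : ℝ) * p ≤ 1 / 4 := le_trans (mul_le_mul_of_nonneg_right
          (Nat.cast_le.2 (Finset.card_le_card (Finset.filter_subset_filter _ hS))) hp) (hdeg e he)
        have h1 := (measureReal_mono hcover).trans ((measureReal_union_le _ _).trans
          (add_le_add_right ((measureReal_biUnion_finset_le S₁ _).trans hsum) _))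
        rw [Finset.sum_const, nsmul_eq_mul] at h1
        have h2 := mul_le_mul_of_nonneg_right hcard
          (measureReal_nonneg (μ := μ) (s := avoid A S₂))
        linarith
    calc μ.real (A e ∩ avoid A S) ≤ μ.real (A e ∩ avoid A S₂) :=
          measureReal_mono (Set.inter_subset_inter_right _ (avoid_anti A hsub))
      _ ≤ p * μ.real (avoid A S₂) := hneg₂
      _ ≤ p * (2 * μ.real (avoid A S)) := mul_le_mul_of_nonneg_left hhalf hp
      _ = 2 * p * μ.real (avoid A S) := by ring

/-- The symmetric lopsided local lemma. -/
theorem pow_card_le_measureReal_avoid [MeasurableSpace Ω] (μ : Measure Ω)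
    [IsProbabilityMeasure μ] (A : ι → Set Ω) (I : Finset ι) (nbr : ι → ι → Prop)
    [∀ e, DecidablePred (nbr e)] {p : ℝ} (hp : 0 ≤ p)
    (hp2 : 2 * p ≤ 1)
    (hneg : ∀ e ∈ I, ∀ S ⊆ I, (∀ f ∈ S, ¬ nbr e f) →
      μ.real (A e ∩ avoid A S) ≤ p * μ.real (avoid A S))
    (hdeg : ∀ e ∈ I, ((I.filter (nbr e)).card : ℝ) * p ≤ 1 / 4) :
    (1 - 2 * p) ^ I.card ≤ μ.real (avoid A I) := by
  classical
  suffices h : ∀ S ⊆ I, (1 - 2 * p) ^ S.card ≤ μ.real (avoid A S) from h I subset_rfl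
  intro S
  induction S using Finset.induction_on with
  | empty => simp [avoid]
  | insert e S heS ih =>
    intro hS
    have hSI := (Finset.subset_insert e S).trans hS
    have h1 := ih hSI
    have h2 := measureReal_inter_avoid_le μ A I nbr hp hneg hdeg S hSI e
      (hS (Finset.mem_insert_self e S))
    have h3 : avoid A S ⊆ (A e ∩ avoid A S) ∪ avoid A (insert e S) := by
      intro ω hω
      by_cases h : ω ∈ A e
      · exact Or.inl ⟨h, hω⟩
      · exact Or.inr fun f hf => (Finset.mem_insert.1 hf).elim (fun e => e ▸ h) (hω f)
    have h4 := (measureReal_mono h3).trans (measureReal_union_le (μ := μ) _ _)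
    rw [Finset.card_insert_of_notMem heS, pow_succ]
    have h5 := mul_le_mul_of_nonneg_right h1 (by linarith : 0 ≤ 1 - 2 * p)
    linarith

end LocalLemma

theorem exp_neg_two_mul_le {x : ℝ} (h0 : 0 ≤ x) (h : x ≤ 1 / 2) : Real.exp (-(2 * x)) ≤ 1 - x := by
  have h1 : 0 < 1 - x := by linarith
  have h2 := Real.add_one_le_exp (2 * x)
  rw [Real.exp_neg]
  refine inv_le_of_inv_le₀ h1 (le_trans ?_ h2)
  rw [inv_le_iff_one_le_mul₀ h1]
  nlinarith

/-! ### Triangle-free pairings -/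

namespace Pairing

variable {n : ℕ} {d : Fin n → ℕ}

/-- The edges of a potential triangle whose vertices carry the given pairs of half-edges. -/
def cornerEdges (e : (HalfEdge d × HalfEdge d) × (HalfEdge d × HalfEdge d) ×
    (HalfEdge d × HalfEdge d)) : List (HalfEdge d × HalfEdge d) :=
  [(e.1.1, e.2.1.1), (e.2.1.2, e.2.2.1), (e.2.2.2, e.1.2)]

/-- The pairs of half-edges at a common vertex. -/
def corners (d : Fin n → ℕ) : Finset (HalfEdge d × HalfEdge d) :=
  Finset.univ.filter fun p => p.1.1 = p.2.1

/-- The triples of corners, made of six distinct half-edges, that can form a triangle. -/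
def cornerTriples (d : Fin n → ℕ) : Finset ((HalfEdge d × HalfEdge d) × (HalfEdge d × HalfEdge d) ×
    (HalfEdge d × HalfEdge d)) :=
  (corners d ×ˢ corners d ×ˢ corners d).filter fun e => (endpoints (cornerEdges e)).Nodup

theorem card_corners : ((corners d).card : ℝ) = degMoment d 2 := by
  have h : (corners d).card = ∑ p : HalfEdge d × HalfEdge d, if p.1.1 = p.2.1 then 1 else 0 := by
    rw [corners, Finset.card_filter]
  rw [h, Fintype.sum_prod_type, Fintype.sum_sigma]
  simp only [Fintype.sum_sigma, degMoment]
  push_cast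
  refine Finset.sum_congr rfl fun i _ => ?_
  simp [sq]

theorem card_corners_filter_le (x : HalfEdge d) :
    ((corners d).filter fun p => p.1 = x ∨ p.2 = x).card ≤ 2 * d x.1 := by
  classical
  have hsub : ((corners d).filter fun p => p.1 = x ∨ p.2 = x) ⊆
      (Finset.univ.image fun b : Fin (d x.1) => (x, (⟨x.1, b⟩ : HalfEdge d))) ∪
        Finset.univ.image fun b : Fin (d x.1) => ((⟨x.1, b⟩ : HalfEdge d), x) := by
    rintro ⟨⟨i, a⟩, ⟨j, b⟩⟩ hp
    simp only [corners, Finset.mem_filter, Finset.mem_univ, true_and] at hp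
    obtain ⟨rfl, h | h⟩ := hp
    · subst h
      exact Finset.mem_union_left _ (Finset.mem_image.2 ⟨b, Finset.mem_univ _, rfl⟩)
    · subst h
      exact Finset.mem_union_right _ (Finset.mem_image.2 ⟨a, Finset.mem_univ _, rfl⟩)
  refine (Finset.card_le_card hsub).trans ((Finset.card_union_le _ _).trans ?_)
  have h1 : ∀ f : Fin (d x.1) → HalfEdge d × HalfEdge d, (Finset.univ.image f).card ≤ d x.1 :=
    fun f => Finset.card_image_le.trans (by simp)
  have := h1 fun b => (x, (⟨x.1, b⟩ : HalfEdge d))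
  have := h1 fun b => ((⟨x.1, b⟩ : HalfEdge d), x)
  omega

theorem card_cornerTriples_le : ((cornerTriples d).card : ℝ) ≤ degMoment d 2 ^ 3 := by
  rw [← card_corners, ← Nat.cast_pow, Nat.cast_le]
  refine (Finset.card_filter_le _ _).trans (le_of_eq ?_)
  rw [Finset.card_product, Finset.card_product]
  ring

theorem le_sqrt_degMoment_two (i : Fin n) : (d i : ℝ) ≤ √(degMoment d 2) :=
  Real.le_sqrt_of_sq_le (Finset.single_le_sum (f := fun i => (d i : ℝ) ^ 2)
    (fun _ _ => by positivity) (Finset.mem_univ i))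

/-- Two triples of corners are neighbours if they share a half-edge. -/
def Touches (e f : (HalfEdge d × HalfEdge d) × (HalfEdge d × HalfEdge d) ×
    (HalfEdge d × HalfEdge d)) : Prop :=
  ∃ x ∈ endpoints (cornerEdges e), x ∈ endpoints (cornerEdges f)

open Classical in
theorem card_filter_touches_le (e : (HalfEdge d × HalfEdge d) × (HalfEdge d × HalfEdge d) ×
    (HalfEdge d × HalfEdge d)) :
    (((cornerTriples d).filter (Touches e)).card : ℝ) ≤
      36 * √(degMoment d 2) * degMoment d 2 ^ 2 := by
  set C := corners d with hC
  set Cx : HalfEdge d → Finset (HalfEdge d × HalfEdge d) :=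
    fun x => C.filter fun p => p.1 = x ∨ p.2 = x with hCx
  have hsub : (cornerTriples d).filter (Touches e) ⊆ (endpoints (cornerEdges e)).toFinset.biUnion
      fun x => (Cx x ×ˢ C ×ˢ C) ∪ (C ×ˢ Cx x ×ˢ C) ∪ (C ×ˢ C ×ˢ Cx x) := by
    intro f hf
    obtain ⟨hf, x, hx, hxf⟩ := Finset.mem_filter.1 hf
    have hf' := (Finset.mem_filter.1 hf).1
    simp only [Finset.mem_product] at hf'
    refine Finset.mem_biUnion.2 ⟨x, List.mem_toFinset.2 hx, ?_⟩
    simp only [endpoints, cornerEdges, List.flatMap_cons, List.flatMap_nil, List.cons_append,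
      List.nil_append, List.mem_cons, List.not_mem_nil, or_false] at hxf
    simp only [hCx, Finset.mem_union, Finset.mem_product, Finset.mem_filter]
    rcases hxf with h | h | h | h | h | h <;> simp [h, hC, hf']
  have hCx2 : ∀ x, ((Cx x).card : ℝ) ≤ 2 * √(degMoment d 2) := fun x => by
    have h1 : ((Cx x).card : ℝ) ≤ ((2 * d x.1 : ℕ) : ℝ) :=
      Nat.cast_le.2 (card_corners_filter_le x)
    push_cast at h1
    linarith [le_sqrt_degMoment_two (d := d) x.1]
  have hx : ∀ x, (((Cx x ×ˢ C ×ˢ C) ∪ (C ×ˢ Cx x ×ˢ C) ∪ (C ×ˢ C ×ˢ Cx x)).card : ℝ) ≤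
      6 * √(degMoment d 2) * degMoment d 2 ^ 2 := fun x => by
    have h1 : ((Cx x ×ˢ C ×ˢ C) ∪ (C ×ˢ Cx x ×ˢ C) ∪ (C ×ˢ C ×ˢ Cx x)).card ≤
        3 * ((Cx x).card * C.card ^ 2) := by
      refine (Finset.card_union_le _ _).trans ((Nat.add_le_add_right
        (Finset.card_union_le _ _) _).trans (le_of_eq ?_))
      simp only [Finset.card_product]
      ring
    have h2 : (((Cx x ×ˢ C ×ˢ C) ∪ (C ×ˢ Cx x ×ˢ C) ∪ (C ×ˢ C ×ˢ Cx x)).card : ℝ) ≤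
        ((3 * ((Cx x).card * C.card ^ 2) : ℕ) : ℝ) := Nat.cast_le.2 h1
    push_cast at h2
    rw [hC, card_corners] at h2
    have h3 := mul_le_mul_of_nonneg_right (hCx2 x) (sq_nonneg (degMoment d 2))
    linarith
  have hcard := (Finset.card_le_card hsub).trans Finset.card_biUnion_le
  have hcard' : (((cornerTriples d).filter (Touches e)).card : ℝ) ≤
      ∑ x ∈ (endpoints (cornerEdges e)).toFinset,
        (((Cx x ×ˢ C ×ˢ C) ∪ (C ×ˢ Cx x ×ˢ C) ∪ (C ×ˢ C ×ˢ Cx x)).card : ℝ) := by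
    exact_mod_cast hcard
  have hsix : ((endpoints (cornerEdges e)).toFinset.card : ℝ) ≤ 6 := by
    have h3 : (cornerEdges e).length = 3 := rfl
    have h := List.toFinset_card_le (endpoints (cornerEdges e))
    rw [length_endpoints, h3] at h
    exact (Nat.cast_le.2 h).trans (by norm_num)
  refine hcard'.trans ((Finset.sum_le_sum fun x _ => hx x).trans ?_)
  rw [Finset.sum_const, nsmul_eq_mul]
  have h0 : 0 ≤ 6 * √(degMoment d 2) * degMoment d 2 ^ 2 :=
    mul_nonneg (mul_nonneg (by norm_num) (Real.sqrt_nonneg _)) (sq_nonneg _)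
  have := mul_le_mul_of_nonneg_right hsix h0
  linarith

/-- Without triangles the bias vanishes. -/
theorem card_mul_TFB_eq_zero (hd : ∀ i, 0 < d i) {σ : Pairing d}
    (h : ∀ e ∈ cornerTriples d, ¬ σ.Contains (cornerEdges e)) : n * TFB σ.adj = 0 := by
  classical
  have htri : ∀ j, triangles σ.adj j = 0 := fun j => by
    rw [triangles]
    refine mul_eq_zero_of_right _ (Finset.sum_eq_zero fun k _ => Finset.sum_eq_zero fun l _ => ?_)
    split_ifs with hjkl
    · obtain ⟨hjk, hkl, hjl⟩ := hjkl
      rw [adj_mul_adj_mul_adj]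
      refine Finset.sum_eq_zero fun a _ => Finset.sum_eq_zero fun b _ => Finset.sum_eq_zero
        fun b' _ => Finset.sum_eq_zero fun c _ => Finset.sum_eq_zero fun c' _ =>
        Finset.sum_eq_zero fun a' _ => if_neg fun hcon => ?_
      obtain ⟨ha, hb, hc⟩ := hcon.ne_of_triangleEdges hjk hkl hjl
      refine h ((⟨j, a⟩, ⟨j, a'⟩), (⟨k, b⟩, ⟨k, b'⟩), (⟨l, c⟩, ⟨l, c'⟩)) ?_ hcon
      refine Finset.mem_filter.2 ⟨by simp [corners], ?_⟩
      exact nodup_endpoints_triangleEdges hjk hkl hjl ha hb hc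
    · rfl
  rw [card_mul_TFB hd]
  simp [htri]

/-- The local lemma applied to the potential triangles. -/
theorem exp_le_CM_real (hd : ∀ i, 0 < d i) (he : Even (∑ i, d i)) {p : ℝ}
    (hp : p = 1 / ((degMoment d 1 - 1) * (degMoment d 1 - 3) * (degMoment d 1 - 5)))
    (hm : 7 < degMoment d 1)
    (hdeg : 36 * √(degMoment d 2) * degMoment d 2 ^ 2 * p ≤ 1 / 4) :
    Real.exp (-(4 * (degMoment d 2 ^ 3 * p))) ≤
      (CM d).real {σ | (n : ℝ) * TFB σ.adj = 0} := by
  classical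
  have := isProbabilityMeasure_CM he
  set m := degMoment d 1 with hm_def
  have hprod : 48 ≤ (m - 1) * (m - 3) * (m - 5) := by
    nlinarith [mul_pos (by linarith : 0 < m - 1) (by linarith : 0 < m - 3),
      mul_pos (mul_pos (by linarith : 0 < m - 1) (by linarith : 0 < m - 3))
        (by linarith : 0 < m - 7)]
  have hp0 : 0 ≤ p := by rw [hp]; positivity
  have hp4 : 2 * p ≤ 1 / 2 := by
    rw [hp, mul_one_div, div_le_div_iff₀ (by linarith) (by norm_num)]
    linarith
  set A : _ → Set (Pairing d) := fun e => {σ | σ.Contains (cornerEdges e)} with hA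
  have hlocal := pow_card_le_measureReal_avoid (CM d) A (cornerTriples d) Touches hp0
    (by linarith) ?_ ?_
  · have h1 : Real.exp (-(4 * (degMoment d 2 ^ 3 * p))) ≤ (1 - 2 * p) ^ (cornerTriples d).card := by
      calc Real.exp (-(4 * (degMoment d 2 ^ 3 * p)))
          ≤ Real.exp ((cornerTriples d).card * (-(2 * (2 * p)))) := by
            refine Real.exp_le_exp.2 ?_
            have := mul_le_mul_of_nonneg_right (card_cornerTriples_le (d := d)) hp0
            linarith
        _ = Real.exp (-(2 * (2 * p))) ^ (cornerTriples d).card := Real.exp_nat_mul _ _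
        _ ≤ (1 - 2 * p) ^ (cornerTriples d).card :=
            pow_le_pow_left₀ (Real.exp_nonneg _) (exp_neg_two_mul_le (by linarith) hp4) _
    refine h1.trans (hlocal.trans (measureReal_mono fun σ hσ => ?_))
    exact card_mul_TFB_eq_zero hd hσ
  · intro e he S _ hS
    have hnd := (Finset.mem_filter.1 he).2
    have hcount := prod_mul_count_contains_avoid_le (cornerEdges e) hnd (by
        have h7 : 7 < ∑ i, d i := by
          rw [hm_def, degMoment_one] at hm
          exact_mod_cast hm
        have h3 : (cornerEdges e).length = 3 := rfl
        omega) (cornerEdges '' (S : Set _)) (by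
          rintro _ ⟨f, hf, rfl⟩ x hx hxf
          exact hS f hf ⟨x, hx, hxf⟩)
    simp only [Set.forall_mem_image, Finset.mem_coe] at hcount
    have h3 : (cornerEdges e).length = 3 := rfl
    rw [h3, ← degMoment_one, ← hm_def] at hcount
    simp only [Finset.prod_range_succ, Finset.prod_range_zero] at hcount
    have h1 : (CM d).real (A e ∩ avoid A S) =
        count (fun σ : Pairing d => σ.Contains (cornerEdges e) ∧
          ∀ ⦃f⦄, f ∈ S → ¬ σ.Contains (cornerEdges f)) / Fintype.card (Pairing d) :=
      CM_real_apply _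
    have h2 : (CM d).real (avoid A S) =
        count (fun σ : Pairing d => ∀ ⦃f⦄, f ∈ S → ¬ σ.Contains (cornerEdges f)) /
          Fintype.card (Pairing d) :=
      CM_real_apply _
    rw [h1, h2, ← mul_div_assoc]
    refine div_le_div_of_nonneg_right ?_ (by positivity)
    rw [hp, one_div_mul_eq_div, le_div_iff₀ (by linarith)]
    refine le_of_eq_of_le ?_ hcount
    push_cast
    ring
  · intro e _
    exact (mul_le_mul_of_nonneg_right (card_filter_touches_le e) hp0).trans hdeg

end Pairing

/-! ### Positive probability of a vanishing bias -/

theorem exp_le_CM_real_of_degMoment_two_le {n : ℕ} {d : Fin n → ℕ} (hd : ∀ i, 0 < d i)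
    (he : Even (∑ i, d i)) {C : ℝ} (hC : 0 < C) (hn : 10 ≤ n) (h2 : degMoment d 2 / n ≤ C)
    (hnC : 1152 ^ 2 * C ^ 5 ≤ n) :
    Real.exp (-(32 * C ^ 3)) ≤ (CM d).real {σ | (n : ℝ) * TFB σ.adj = 0} := by
  have hn' : (10 : ℝ) ≤ n := by exact_mod_cast hn
  have hn0 : (0 : ℝ) < n := by linarith
  set m := degMoment d 1 with hm
  have hmn : (n : ℝ) ≤ m := by
    have := one_le_degMoment_div (by omega) hd
    rwa [le_div_iff₀ hn0, one_mul] at this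
  rw [div_le_iff₀ hn0] at h2
  have h20 : 0 ≤ degMoment d 2 := Finset.sum_nonneg fun i _ => by positivity
  have hprod : (n : ℝ) ^ 3 / 8 ≤ (m - 1) * (m - 3) * (m - 5) := by
    have ha : (n : ℝ) / 2 ≤ m - 1 := by linarith
    have hb : (n : ℝ) / 2 ≤ m - 3 := by linarith
    have hc : (n : ℝ) / 2 ≤ m - 5 := by linarith
    have ha0 : 0 ≤ m - 1 := by linarith
    have hb0 : 0 ≤ m - 3 := by linarith
    calc (n : ℝ) ^ 3 / 8 = (n : ℝ) / 2 * (n / 2) * (n / 2) := by ring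
      _ ≤ (m - 1) * (m - 3) * (m - 5) := by gcongr
  have hp : 1 / ((m - 1) * (m - 3) * (m - 5)) ≤ 8 / (n : ℝ) ^ 3 := by
    rw [div_le_div_iff₀ (lt_of_lt_of_le (by positivity) hprod) (by positivity)]
    linarith
  have hp0 : 0 ≤ 1 / ((m - 1) * (m - 3) * (m - 5)) :=
    one_div_nonneg.2 (le_trans (by positivity) hprod)
  refine le_trans (Real.exp_le_exp.2 (neg_le_neg ?_))
    (Pairing.exp_le_CM_real hd he rfl (by linarith) ?_)
  · calc 4 * (degMoment d 2 ^ 3 * (1 / ((m - 1) * (m - 3) * (m - 5))))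
        ≤ 4 * ((C * n) ^ 3 * (8 / (n : ℝ) ^ 3)) := by gcongr
      _ = 32 * C ^ 3 := by
        field_simp
        ring
  · have hs : 1152 * C ^ 2 * √(C * n) ≤ n := by
      rw [← sq_le_sq₀ (by positivity) hn0.le, mul_pow, Real.sq_sqrt (by positivity)]
      nlinarith
    calc 36 * √(degMoment d 2) * degMoment d 2 ^ 2 * (1 / ((m - 1) * (m - 3) * (m - 5)))
        ≤ 36 * √(C * n) * (C * n) ^ 2 * (8 / (n : ℝ) ^ 3) := by gcongr
      _ = 1152 * C ^ 2 * √(C * n) / n / 4 := by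
        field_simp
        ring
      _ ≤ 1 / 4 := by
        refine div_le_div_of_nonneg_right ?_ (by norm_num)
        rwa [div_le_one hn0]

theorem exists_le_CM_eq_zero {N : ℕ → ℕ} {d : ∀ r, Fin (N r) → ℕ} {c₂ : ℝ}
    (hN : Tendsto N atTop atTop) (hd : ∀ r i, 0 < d r i) (he : ∀ r, Even (∑ i, d r i))
    (hc₂ : 0 < c₂)
    (h2 : Tendsto (fun r => degMoment (d r) 2 / (N r : ℝ)) atTop (𝓝 c₂)) :
    ∃ δ > 0, ∀ᶠ r in atTop,
      ENNReal.ofReal δ ≤ CM (d r) {σ | (N r : ℝ) * TFB σ.adj = 0} := by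
  refine ⟨Real.exp (-(32 * (c₂ + 1) ^ 3)), Real.exp_pos _, ?_⟩
  have hN' : Tendsto (fun r => (N r : ℝ)) atTop atTop := tendsto_natCast_atTop_atTop.comp hN
  filter_upwards [hN.eventually_ge_atTop 10, h2.eventually_le_const (lt_add_one c₂),
    hN'.eventually_ge_atTop (1152 ^ 2 * (c₂ + 1) ^ 5)] with r h10 hle hlarge
  have := isProbabilityMeasure_CM (he r)
  refine (ENNReal.ofReal_le_ofReal (exp_le_CM_real_of_degMoment_two_le (hd r) (he r)
    (by linarith) h10 hle hlarge)).trans (le_of_eq ?_)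
  exact ofReal_measureReal

/-- Where the total bias vanishes, it deviates from its expectation by about `|z|`. As this has
probability bounded below, the weak law of large numbers fails. -/
theorem not_tendsto_deviation {N : ℕ → ℕ} {d : ∀ r, Fin (N r) → ℕ} {z δ : ℝ}
    (hE : Tendsto (fun r => ∫ σ, (N r : ℝ) * TFB σ.adj ∂(CM (d r))) atTop (𝓝 z)) (hz : z ≠ 0)
    (hδ : 0 < δ) (hP : ∀ᶠ r in atTop,
      ENNReal.ofReal δ ≤ CM (d r) {σ | (N r : ℝ) * TFB σ.adj = 0}) :
    ¬ ∀ ε : ℝ, 0 < ε → Tendsto (fun r => CM (d r) {σ | ε ≤ |(N r : ℝ) * TFB σ.adj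
        - ∫ τ, (N r : ℝ) * TFB τ.adj ∂(CM (d r))|}) atTop (𝓝 0) := by
  intro h
  have hlim := h (|z| / 2) (by positivity)
  have hfar : ∀ᶠ r in atTop, |z| / 2 < |∫ σ, (N r : ℝ) * TFB σ.adj ∂(CM (d r))| :=
    hE.abs.eventually_const_lt (half_lt_self (abs_pos.2 hz))
  have hle : ENNReal.ofReal δ ≤ 0 := by
    refine ge_of_tendsto hlim ?_
    filter_upwards [hfar, hP] with r h1 h2
    refine h2.trans (measure_mono fun σ hσ => ?_)
    have hσ' : (N r : ℝ) * TFB σ.adj = 0 := hσ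
    change |z| / 2 ≤ _
    rw [hσ', zero_sub, abs_neg]
    exact h1.le
  exact (ENNReal.ofReal_pos.2 hδ).not_ge hle

theorem theorem1p10 :
    -- (a)
    (∀ (n : ℕ) (d : Fin n → ℕ), (∀ i, 0 < d i) → Even (∑ i, d i) → 7 < degMoment d 1 →
      ∫ σ, TFB σ.adj ∂(CM d) =
        1 / (2 * (degMoment d 1 - 1) * (degMoment d 1 - 3) * (degMoment d 1 - 5) * (degMoment d 1 - 7)) *
          (polyA (degMoment d) / n + polyB (degMoment d))) ∧
    -- (b) and (c), along any sequence `N r → ∞` of numbers of vertices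
    (∀ (N : ℕ → ℕ) (d : ∀ r, Fin (N r) → ℕ) (c : ℕ → ℝ),
      Tendsto N atTop atTop →
      (∀ r i, 0 < d r i) →
      (∀ r, Even (∑ i, d r i)) →
      (∀ k, 1 ≤ k → k ≤ 7 →
        0 < c k ∧ Tendsto (fun r => degMoment (d r) k / (N r : ℝ)) atTop (𝓝 (c k))) →
      -- (b)
      (Tendsto (fun r => ∫ σ, (N r : ℝ) * TFB σ.adj ∂(CM (d r))) atTop
          (𝓝 (zeta (c 1) (c 2) (c 3))) ∧
        0 ≤ zeta (c 1) (c 2) (c 3) ∧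
        (zeta (c 1) (c 2) (c 3) = 0 ↔
          c 2 = c 1 ^ 2 ∨
            Tendsto (fun r => fractionOf (d r) (fun x => 3 ≤ x)) atTop (𝓝 0)) ∧
        (c 2 = c 1 ^ 2 ↔
          ∃ D : ℕ, 1 ≤ D ∧
            Tendsto (fun r => fractionOf (d r) (fun x => x ≠ D)) atTop (𝓝 0) ∧
            ∀ k, 1 ≤ k → k ≤ 6 → c k = (D : ℝ) ^ k)) ∧
      -- (c)
      (0 < liminf (fun r => CM (d r) {σ | (N r : ℝ) * TFB σ.adj = 0}) atTop ∧
        (zeta (c 1) (c 2) (c 3) ≠ 0 →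
          ¬ ∀ ε : ℝ, 0 < ε →
            Tendsto (fun r => CM (d r)
              {σ | ε ≤ |(N r : ℝ) * TFB σ.adj
                - ∫ τ, (N r : ℝ) * TFB τ.adj ∂(CM (d r))|}) atTop (𝓝 0)))) := by
  refine ⟨fun n d hd he hm => expected_TFB hd he hm, fun N d c hN hd he hc => ?_⟩
  -- the empirical moment of order `0` is `1`
  set c' : ℕ → ℝ := fun k => if k = 0 then 1 else c k with hc'
  have hlim : ∀ k ≤ 7, Tendsto (fun r => degMoment (d r) k / (N r : ℝ)) atTop (𝓝 (c' k)) := by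
    intro k hk
    rcases Nat.eq_zero_or_pos k with rfl | hpos
    · refine tendsto_const_nhds.congr' ?_
      filter_upwards [hN.eventually_gt_atTop 0] with r hr
      have : (N r : ℝ) ≠ 0 := by exact_mod_cast hr.ne'
      simp [degMoment_zero, hc', this]
    · simpa [hc', hpos.ne'] using (hc k hpos hk).2
  have h0 : c' 0 = 1 := rfl
  have h1 : 0 < c' 1 := (hc 1 le_rfl (by omega)).1
  have hE : Tendsto (fun r => ∫ σ, (N r : ℝ) * TFB σ.adj ∂(CM (d r))) atTop
      (𝓝 (zeta (c 1) (c 2) (c 3))) := tendsto_expected_TFB (c := c') hN hd he hlim h1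
  obtain ⟨hz, hziff⟩ := zeta_nonneg_and_eq_zero_iff hN hd hlim h0 h1
  obtain ⟨h2pos, h2⟩ := hc 2 (by omega) (by omega)
  obtain ⟨δ, hδ, hP⟩ := exists_le_CM_eq_zero hN hd he h2pos h2
  refine ⟨⟨hE, hz, hziff, ?_⟩, ?_, fun hne => not_tendsto_deviation hE hne hδ hP⟩
  · rw [show c 2 = c 1 ^ 2 ↔ c' 2 = c' 1 ^ 2 from Iff.rfl,
      variance_eq_zero_iff_regular hN hlim h0 h1]
    refine exists_congr fun D => and_congr_right fun _ => and_congr_right fun _ =>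
      forall_congr' fun k => forall_congr' fun hk => ?_
    rw [show c' k = c k from if_neg (by omega)]
  · exact lt_of_lt_of_le (ENNReal.ofReal_pos.2 hδ) (le_liminf_of_le (by isBoundedDefault) hP)
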